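/- Let $0<\lambda<\lambda_+$, where $\lambda_+=2\cos(4\pi/9)\approx 0.347$ is the root of $x^3-3x+1$ in $(0,1)$. On $\Omega=[0,1)^2$ let $$F(x,y)=(\lambda x-y+\iota(x,y),\,x),\qquad \iota(x,y)=-\lfloor \lambda x-y\rfloor,\qquad G(x,y)=(y,x).$$ For $i\in\{0,1\}$ let $F_{(i)}(x,y)=(\lambda x-y+i,\,x)$ on $\mathbb R^2$, and for a finite word $w=(w_0,\dots,w_{k-1})$ let $F_w=F_{(w_{k-1})}\circ\cdots\circ F_{(w_0)}$. Put $$\rho=\tfrac1{2\pi}\arccos(\lambda/2),\qquad \theta=\arcsin(\lambda/2),\qquad M=\left\lfloor \frac1{2(1-4\rho)}-\frac12\right\rfloor ,$$ $$g=\frac{1+2\lambda-\lambda^2-\lambda^3}{2-\lambda^2},\qquad g''=\frac1{1+\lambda-\lambda^2}.$$ Let $\Lambda$ be the right triangle with vertices $(1,1),(g,1),(1,g'')$, containing its hypotenuse except for the end-points and none of the other boundary points. The map $L^{\rm out}$ sends $z\in\Lambda$ to $F^{k}(G(z))$, where $k\ge1$ is the least positive integer with $F^{k}(G(z))\in\Lambda$;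 it is defined where such a $k$ exists. Define (with the quotient of tangents read as $0$ when $(2m+1)\theta=\pi/2$) $$P_0(m)=\left(\tfrac12\Bigl(1+2\lambda+\tfrac{\tan\theta}{\tan (2m+1)\theta}\Bigr),\,1\right)\qquad(1\le m\le M),$$ $$P_1(m)=\left(\tfrac12\Bigl(1+2\lambda-\lambda^2+\lambda^4+(1-3\lambda^2+\lambda^4)\tfrac{\tan\theta}{\tan(2m-1)\theta}\Bigr),\;1+\tfrac{\lambda^3}2+\tfrac{\lambda}{2}(\lambda^2-2)\tfrac{\tan\theta}{\tan(2m-1)\theta}\right)\qquad(2\le m\le M),$$ $$P_1(0)=\left(1,\tfrac{2-\lambda-\lambda^2}{2-4\lambda^2+\lambda^4}\right),\qquad P_1(1)=\left(1,\tfrac{2-2\lambda-4\lambda^2+\lambda^3+\lambda^4}{2-9\lambda^2+6\lambda^4-\lambda^6}\right),$$ $$P'=(1-2\lambda^2+6\lambda^3+\lambda^4-5\lambda^5+\lambda^7,\;1-\lambda+3\lambda^2+\lambda^3-4\lambda^4+\lambda^6),$$ and, with $D=1-6\lambda^2+5\lambda^4-\lambda^6$, $$P''=\left(1,\tfrac{1-\lambda-3\lambda^2+\lambda^3+\lambda^4}{D}\right),$$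 $$P'''=\left(\tfrac{1-6\lambda^2-3\lambda^3+11\lambda^4+4\lambda^5-12\lambda^6-\lambda^7+6\lambda^8-\lambda^{10}}{D},\;\tfrac{1-\lambda-4\lambda^2+3\lambda^3+4\lambda^4-7\lambda^5-\lambda^6+5\lambda^7-\lambda^9}{D}\right).$$ Let $\Lambda_m^{\rm out}$ be the open convex polygon (the interior of the convex hull of the vertices) $$\Lambda_1^{\rm out}=[P_0(1),(1,1),P_1(0),P'],\qquad \Lambda_2^{\rm out}=[P_0(2),P_0(1),P'',P_1(1),P''',P_1(2)],$$ $$\Lambda_m^{\rm out}=[P_0(m),P_0(m-1),P_1(m-1),P_1(m)]\quad(3\le m\le M).$$ Then for every $1\le m\le M$ the polygon $\Lambda_m^{\rm out}$ is contained in the part of $\Lambda$ where $L^{\rm out}$ is defined; on $\Lambda_m^{\rm out}$ the three maps $L^{\rm out}$, $F^{4m+3}\circ G$ and $F_{(1^3(0,1)^{2m-1}1^2)}\circ G$ coincide, and $$L^{\rm out}(\Lambda^{\rm out}_m)=F^{4m+3}\circ G(\Lambda^{\rm out}_m)=F_{(1^3(0,1)^{2m-1}1^2)}\circ G(\Lambda^{\rm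 out}_m)=\Lambda^{\rm out}_m .$$ Moreover, the set of fixed points of $L^{\rm out}$ in the open polygon $\Lambda_m^{\rm out}$ is exactly the segment from $P_0(m)$ to $P_1(m-1)$ without its end-points, and the set of fixed points of the affine extension $F_{(1^3(0,1)^{2m-1}1^2)}\circ G$ in the closed polygon $\overline{\Lambda_m^{\rm out}}$ is exactly the closed segment $[P_0(m),P_1(m-1)]$. -/

import Mathlib

namespace PiecewiseRotation

noncomputable section

/-- The affine map `F_(i) : z ↦ C z + (i, 0)` of the plane, where `C` is the matrix
`[[lam, -1], [1, 0]]`. -/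
def step (lam : ℝ) (i : ℤ) (z : ℝ × ℝ) : ℝ × ℝ :=
  (lam * z.1 - z.2 + i, z.1)

/-- The coding function `ι (x, y) = -⌊lam * x - y⌋`. -/
def iota (lam : ℝ) (z : ℝ × ℝ) : ℤ :=
  -⌊lam * z.1 - z.2⌋

/-- The piecewise isometry `F (x, y) = (lam * x - y + ι (x, y), x)`. It maps the unit square
`[0, 1) × [0, 1)` to itself, and it is only ever iterated from points of that square. -/
def F (lam : ℝ) (z : ℝ × ℝ) : ℝ × ℝ :=
  step lam (iota lam z) z

/-- The reflection `G (x, y) = (y, x)`. -/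
def G (z : ℝ × ℝ) : ℝ × ℝ :=
  (z.2, z.1)

/-- For a code `w = (w₀, …, w_{k-1})`, the affine map `F_w = F_(w_{k-1}) ∘ ⋯ ∘ F_(w₀)`. -/
def codeMap (lam : ℝ) (w : List ℤ) (z : ℝ × ℝ) : ℝ × ℝ :=
  w.foldl (fun u i => step lam i u) z

/-- The code `(1³ (0,1)^(2m-1) 1²)`. -/
def outCode (m : ℕ) : List ℤ :=
  [1, 1, 1] ++ (List.replicate (2 * m - 1) [0, 1]).flatten ++ [1, 1]

/-- The rotation number `ρ`, with `lam = 2 cos (2πρ)`. -/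
def rho (lam : ℝ) : ℝ :=
  Real.arccos (lam / 2) / (2 * Real.pi)

/-- `θ = π/2 - 2πρ`. -/
def theta (lam : ℝ) : ℝ :=
  Real.arcsin (lam / 2)

/-- The number `M` of regular atoms of the outer map. -/
def M (lam : ℝ) : ℕ :=
  ⌊1 / (2 * (1 - 4 * rho lam)) - 1 / 2⌋₊

/-- The abscissa `g` of the end-point `(g, 1)` of the hypotenuse of `domain`. -/
def g (lam : ℝ) : ℝ :=
  (1 + 2 * lam - lam ^ 2 - lam ^ 3) / (2 - lam ^ 2)

/-- The ordinate `g''` of the end-point `(1, g'')` of the hypotenuse of `domain`. -/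
def gpp (lam : ℝ) : ℝ :=
  1 / (1 + lam - lam ^ 2)

/-- The right triangle `Λ` with vertices `(1, 1)`, `(g, 1)`, `(1, g'')`. The hypotenuse belongs
to `Λ`, the two legs (on the lines `x = 1` and `y = 1`) do not. -/
def domain (lam : ℝ) : Set (ℝ × ℝ) :=
  {z | z.1 < 1 ∧ z.2 < 1 ∧ 0 ≤ (1 - gpp lam) * (z.1 - g lam) + (1 - g lam) * (z.2 - 1)}

/-- The positive times at which the `F`-orbit of `G z` is in `Λ`. -/
def returnTimes (lam : ℝ) (z : ℝ × ℝ) : Set ℕ :=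
  {k | 1 ≤ k ∧ (F lam)^[k] (G z) ∈ domain lam}

/-- The points of `Λ` at which the outer map is defined. -/
def LoutDomain (lam : ℝ) : Set (ℝ × ℝ) :=
  {z | z ∈ domain lam ∧ (returnTimes lam z).Nonempty}

/-- The outer map `L^out`: the reflection `G : Λ → G(Λ)` followed by the transit map
`G(Λ) → Λ` that sends a point to its first image under `F, F², F³, …` lying in `Λ`.
It is meaningful on `LoutDomain lam`. -/
def Lout (lam : ℝ) (z : ℝ × ℝ) : ℝ × ℝ :=
  (F lam)^[sInf (returnTimes lam z)] (G z)

/-- The vertex `P₀(m)`, for `1 ≤ m ≤ M`. At `(2m+1)θ = π/2` the quotient of tangents is `0`. -/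
def P0 (lam : ℝ) (m : ℕ) : ℝ × ℝ :=
  ((1 + 2 * lam + Real.tan (theta lam) / Real.tan ((2 * (m : ℝ) + 1) * theta lam)) / 2, 1)

/-- The vertex `P₁(m)`, for `0 ≤ m ≤ M`; the first two are on the line `x = 1`. -/
def P1 (lam : ℝ) : ℕ → ℝ × ℝ
  | 0 => (1, (2 - lam - lam ^ 2) / (2 - 4 * lam ^ 2 + lam ^ 4))
  | 1 => (1, (2 - 2 * lam - 4 * lam ^ 2 + lam ^ 3 + lam ^ 4) /
      (2 - 9 * lam ^ 2 + 6 * lam ^ 4 - lam ^ 6))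
  | m + 2 =>
    ((1 + 2 * lam - lam ^ 2 + lam ^ 4 + (1 - 3 * lam ^ 2 + lam ^ 4) *
        (Real.tan (theta lam) / Real.tan ((2 * ((m + 2 : ℕ) : ℝ) - 1) * theta lam))) / 2,
      1 + lam ^ 3 / 2 + lam / 2 * (lam ^ 2 - 2) *
        (Real.tan (theta lam) / Real.tan ((2 * ((m + 2 : ℕ) : ℝ) - 1) * theta lam)))

/-- The vertex `P'` of the first polygon. -/
def Pprime (lam : ℝ) : ℝ × ℝ :=
  (1 - 2 * lam ^ 2 + 6 * lam ^ 3 + lam ^ 4 - 5 * lam ^ 5 + lam ^ 7,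
    1 - lam + 3 * lam ^ 2 + lam ^ 3 - 4 * lam ^ 4 + lam ^ 6)

/-- The vertex `P''` of the second polygon. -/
def Psecond (lam : ℝ) : ℝ × ℝ :=
  (1, (1 - lam - 3 * lam ^ 2 + lam ^ 3 + lam ^ 4) / (1 - 6 * lam ^ 2 + 5 * lam ^ 4 - lam ^ 6))

/-- The vertex `P'''` of the second polygon. -/
def Pthird (lam : ℝ) : ℝ × ℝ :=
  ((1 - 6 * lam ^ 2 - 3 * lam ^ 3 + 11 * lam ^ 4 + 4 * lam ^ 5 - 12 * lam ^ 6 - lam ^ 7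
      + 6 * lam ^ 8 - lam ^ 10) / (1 - 6 * lam ^ 2 + 5 * lam ^ 4 - lam ^ 6),
    (1 - lam - 4 * lam ^ 2 + 3 * lam ^ 3 + 4 * lam ^ 4 - 7 * lam ^ 5 - lam ^ 6 + 5 * lam ^ 7
      - lam ^ 9) / (1 - 6 * lam ^ 2 + 5 * lam ^ 4 - lam ^ 6))

/-- The vertices of the polygon `Λ_m^out`, `m ≥ 1`: a quadrilateral for `m ≠ 2`, a hexagon
for `m = 2`. -/
def outVertices (lam : ℝ) : ℕ → Set (ℝ × ℝ)
  | 0 => ∅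
  | 1 => {P0 lam 1, (1, 1), P1 lam 0, Pprime lam}
  | 2 => {P0 lam 2, P0 lam 1, Psecond lam, P1 lam 1, Pthird lam, P1 lam 2}
  | m + 3 => {P0 lam (m + 3), P0 lam (m + 2), P1 lam (m + 2), P1 lam (m + 3)}

/-- The closed convex polygon with vertices `outVertices lam m`. -/
def closedAtomOut (lam : ℝ) (m : ℕ) : Set (ℝ × ℝ) :=
  convexHull ℝ (outVertices lam m)

/-- The polygon `Λ_m^out`, without its boundary. -/
def atomOut (lam : ℝ) (m : ℕ) : Set (ℝ × ℝ) :=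
  interior (closedAtomOut lam m)

end

end PiecewiseRotation

namespace PiecewiseRotation

/-! The code $1^3(01)^{2m-1}1^2$ is a palindrome, and `step lam i ∘ G` is an involution for each
symbol $i$. Hence `ret`, the affine map $F_w\circ G$, is an involution, and the orbit of `ret lam m
z` is the reflected orbit of $z$ read backwards (`orbit_ret`).

Coding and first return reduce to the vertices. The conditions in `admissible` (both ends in the
closed triangle, abscissae in $[0,1)$ in between, abscissae at most $1/2$ at even times) are
preserved by convex combinations, because each orbit point depends affinely on $z$. They make the
code the true itinerary and keep the orbit off the triangle until time $4m+3$, at least for interior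
points of the polygon, where the inequalities on the legs are strict. Invariance also reduces to the
vertices: `ret` permutes them, hence preserves the hull and its interior.

For the fixed set, $z\mapsto$ midpoint of $z$ and its image is affine and is the identity exactly on
fixed points. If it sends every vertex into the segment $[P,Q]$ between two fixed vertices, then
that segment is the whole fixed set (`fixed_convexHull`). `outer_atom` assembles all this.

It remains to compute orbits of vertices. Along an orbit the abscissae satisfy $X_{k+2}=\lambda
X_{k+1}-X_k+w_k$, so they are a 2-periodic sequence plus a sinusoid of step $\pi/2-\theta$, with a
correction at both ends caused by the two extra symbols 1 (`wave`). $P_0(j)$ and $P_1(j+1)$,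
$j\ge1$, are the two ends of one sinusoid, whose amplitude puts $P_0(j)$ on the line $y=1$; the
estimates are then trigonometric. The remaining vertices of the first two polygons are rational in
$\lambda$, and their orbits are written out as polynomials. The hypothesis $\lambda<\lambda_+$
enters as $1-3\lambda+\lambda^3>0$ and $\lambda<7/20$. -/

/-- The `k`-th symbol of the code `(1³ (0,1)^(2m-1) 1²)`. -/
def symbol (m k : ℕ) : ℤ :=
  if k % 2 = 0 ∨ k = 1 ∨ k = 4 * m + 1 then 1 else 0

/-- The orbit of `G z` under the successive affine maps prescribed by `outCode m`. -/
noncomputable def orbit (lam : ℝ) (m : ℕ) (z : ℝ × ℝ) : ℕ → ℝ × ℝ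
  | 0 => G z
  | k + 1 => step lam (symbol m k) (orbit lam m z k)

/-- The affine involution `F_(1³ (0,1)^(2m-1) 1²) ∘ G`. -/
noncomputable def ret (lam : ℝ) (m : ℕ) (z : ℝ × ℝ) : ℝ × ℝ :=
  orbit lam m z (4 * m + 3)

/-- The affine function vanishing on the hypotenuse of `domain lam`. -/
noncomputable def ell (lam : ℝ) (z : ℝ × ℝ) : ℝ :=
  (1 - gpp lam) * (z.1 - g lam) + (1 - g lam) * (z.2 - 1)

/-- The closed triangle that is the closure of `domain lam`. -/
def corner (lam : ℝ) : Set (ℝ × ℝ) :=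
  {z | z.1 ≤ 1 ∧ z.2 ≤ 1 ∧ 0 ≤ ell lam z}

/-- Points whose orbit starts and ends in the closed triangle and stays away from it
in between. -/
def admissible (lam : ℝ) (m : ℕ) : Set (ℝ × ℝ) :=
  {z | z ∈ corner lam ∧ ret lam m z ∈ corner lam ∧
    ∀ k, 1 ≤ k → k ≤ 4 * m + 1 → 0 ≤ (orbit lam m z k).1 ∧ (orbit lam m z k).1 < 1 ∧
      (k % 2 = 0 → (orbit lam m z k).1 ≤ 1 / 2)}

/-! ### The code -/

theorem flatten_replicate_eq_map (n : ℕ) :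
    (List.replicate n [(0 : ℤ), 1]).flatten =
      (List.range (2 * n)).map (fun i => if i % 2 = 0 then 0 else 1) := by
  induction n with
  | zero => simp
  | succ n ih =>
    rw [List.replicate_succ', List.flatten_append, ih, show 2 * (n + 1) = 2 * n + 1 + 1 by ring,
      List.range_succ, List.range_succ]
    simp

theorem outCode_eq_map (m : ℕ) (hm : 1 ≤ m) :
    outCode m = (List.range (4 * m + 3)).map (symbol m) := by
  obtain ⟨n, rfl⟩ : ∃ n, m = n + 1 := ⟨m - 1, by omega⟩
  rw [outCode, flatten_replicate_eq_map]
  apply List.ext_getElem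
  · simp; omega
  · intro i h1 h2
    simp only [List.length_map, List.length_range] at h2
    simp only [List.getElem_append, List.getElem_map, List.getElem_range, symbol]
    simp only [List.length_append, List.length_map, List.length_range, List.length_cons,
      List.length_nil]
    split_ifs <;> first | omega | skip
    all_goals
      first
      | (have : i = 0 ∨ i = 1 ∨ i = 2 := by omega
         rcases this with rfl | rfl | rfl <;> rfl)
      | (have : i - (3 + 2 * (2 * (n + 1) - 1)) = 0 ∨ i - (3 + 2 * (2 * (n + 1) - 1)) = 1 := by omega
         rcases this with h | h <;> simp_all)

theorem codeMap_map_range (lam : ℝ) (m : ℕ) (z : ℝ × ℝ) (n : ℕ) :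
    codeMap lam ((List.range n).map (symbol m)) (G z) = orbit lam m z n := by
  induction n with
  | zero => rfl
  | succ n ih =>
    rw [codeMap] at *
    rw [List.range_succ, List.map_append, List.foldl_append, ih]
    rfl

theorem codeMap_outCode (lam : ℝ) (m : ℕ) (hm : 1 ≤ m) (z : ℝ × ℝ) :
    codeMap lam (outCode m) (G z) = ret lam m z := by
  rw [outCode_eq_map m hm, codeMap_map_range, ret]

theorem symbol_reverse (m k : ℕ) (hk : k ≤ 4 * m + 2) :
    symbol m (4 * m + 2 - k) = symbol m k := by
  unfold symbol
  congr 1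
  apply propext
  omega

theorem step_G_step (lam : ℝ) (i : ℤ) (z : ℝ × ℝ) : step lam i (G (step lam i z)) = G z := by
  ext
  · simp only [step, G]
    ring
  · rfl

theorem orbit_succ_snd (lam : ℝ) (m : ℕ) (z : ℝ × ℝ) (k : ℕ) :
    (orbit lam m z (k + 1)).2 = (orbit lam m z k).1 := rfl

/-- The code is a palindrome, so the orbit of the image is the orbit read backwards. -/
theorem orbit_ret (lam : ℝ) (m : ℕ) (z : ℝ × ℝ) (k : ℕ) (hk : k ≤ 4 * m + 3) :
    orbit lam m (ret lam m z) k = G (orbit lam m z (4 * m + 3 - k)) := by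
  induction k with
  | zero => rfl
  | succ k ih =>
    have h1 : 4 * m + 3 - k = (4 * m + 2 - k) + 1 := by omega
    have h2 : 4 * m + 3 - (k + 1) = 4 * m + 2 - k := by omega
    rw [orbit, ih (by omega), h1, h2, orbit, symbol_reverse m k (by omega), step_G_step]

theorem ret_ret (lam : ℝ) (m : ℕ) (z : ℝ × ℝ) : ret lam m (ret lam m z) = z := by
  rw [ret, orbit_ret _ _ _ _ le_rfl, Nat.sub_self]
  rfl

theorem orbit_eq_of_recurrence (lam : ℝ) (m : ℕ) (X : ℕ → ℝ) (n : ℕ)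
    (h : ∀ k < n, X (k + 2) = lam * X (k + 1) - X k + symbol m k) (k : ℕ) (hk : k ≤ n) :
    orbit lam m (X 0, X 1) k = (X (k + 1), X k) := by
  induction k with
  | zero => rfl
  | succ k ih => rw [orbit, ih (by omega), step, h k (by omega)]

/-- The translation parts survive because the weights add up to 1; this is what lets every orbit
condition be tested on vertices only. -/
theorem orbit_combo (lam : ℝ) (m : ℕ) (z w : ℝ × ℝ) (a b : ℝ) (hab : a + b = 1) (k : ℕ) :
    orbit lam m (a • z + b • w) k = a • orbit lam m z k + b • orbit lam m w k := by
  induction k with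
  | zero => rfl
  | succ k ih =>
    simp only [orbit, ih, step]
    ext
    · simp
      linear_combination (-(symbol m k : ℝ)) * hab
    · simp

theorem continuous_orbit (lam : ℝ) (m k : ℕ) : Continuous fun z => orbit lam m z k := by
  induction k with
  | zero => exact continuous_snd.prodMk continuous_fst
  | succ k ih =>
    simp only [orbit, step]
    fun_prop

/-- `ret` as a homeomorphism. -/
noncomputable def retHomeo (lam : ℝ) (m : ℕ) : (ℝ × ℝ) ≃ₜ (ℝ × ℝ) where
  toFun := ret lam m
  invFun := ret lam m
  left_inv := ret_ret lam m
  right_inv := ret_ret lam m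
  continuous_toFun := continuous_orbit lam m _
  continuous_invFun := continuous_orbit lam m _

/-! ### Convexity -/

theorem ell_combo (lam : ℝ) (z w : ℝ × ℝ) (a b : ℝ) (hab : a + b = 1) :
    ell lam (a • z + b • w) = a * ell lam z + b * ell lam w := by
  obtain rfl : b = 1 - a := by linarith
  simp [ell]
  ring

theorem convex_corner (lam : ℝ) : Convex ℝ (corner lam) := by
  rintro z ⟨hz1, hz2, hz3⟩ w ⟨hw1, hw2, hw3⟩ a b ha hb hab
  refine ⟨?_, ?_, ?_⟩
  · simp only [Prod.fst_add, Prod.smul_fst, smul_eq_mul]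
    nlinarith
  · simp only [Prod.snd_add, Prod.smul_snd, smul_eq_mul]
    nlinarith
  · rw [ell_combo _ _ _ _ _ hab]
    positivity

theorem convex_admissible (lam : ℝ) (m : ℕ) : Convex ℝ (admissible lam m) := by
  rintro z ⟨hz1, hz2, hz3⟩ w ⟨hw1, hw2, hw3⟩ a b ha hb hab
  refine ⟨convex_corner lam hz1 hw1 ha hb hab, ?_, fun k hk1 hk2 => ?_⟩
  · rw [ret, orbit_combo _ _ _ _ _ _ hab]
    exact convex_corner lam hz2 hw2 ha hb hab
  · obtain ⟨p1, p2, p3⟩ := hz3 k hk1 hk2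
    obtain ⟨q1, q2, q3⟩ := hw3 k hk1 hk2
    rw [orbit_combo _ _ _ _ _ _ hab]
    simp only [Prod.fst_add, Prod.smul_fst, smul_eq_mul]
    refine ⟨by positivity, ?_, fun h => ?_⟩
    · exact convex_Iio (1 : ℝ) p2 q2 ha hb hab
    · exact convex_Iic (1 / 2 : ℝ) (p3 h) (q3 h) ha hb hab

theorem ret_mem_admissible {lam : ℝ} {m : ℕ} {z : ℝ × ℝ} (hz : z ∈ admissible lam m) :
    ret lam m z ∈ admissible lam m := by
  obtain ⟨h1, h2, h3⟩ := hz
  refine ⟨h2, by rwa [ret_ret], fun k hk1 hk2 => ?_⟩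
  rw [orbit_ret _ _ _ _ (by omega), show 4 * m + 3 - k = (4 * m + 2 - k) + 1 by omega]
  change 0 ≤ (orbit lam m z (4 * m + 2 - k + 1)).2 ∧ (orbit lam m z (4 * m + 2 - k + 1)).2 < 1 ∧
    (_ → (orbit lam m z (4 * m + 2 - k + 1)).2 ≤ 1 / 2)
  rw [orbit_succ_snd]
  obtain ⟨p1, p2, p3⟩ := h3 (4 * m + 2 - k) (by omega) (by omega)
  exact ⟨p1, p2, fun h => p3 (by omega)⟩

/-! ### Size of the triangle -/

theorem g_bounds {lam : ℝ} (h0 : 0 < lam) (h1 : lam < 7 / 20) : (1 + lam) / 2 < g lam ∧ g lam < 1 := by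
  have hd : 0 < 2 - lam ^ 2 := by nlinarith
  constructor
  · rw [g, lt_div_iff₀ hd]
    nlinarith [pow_pos h0 2, pow_pos h0 3]
  · rw [g, div_lt_one hd]
    nlinarith [pow_pos h0 2, pow_pos h0 3]

theorem gpp_bounds {lam : ℝ} (h0 : 0 < lam) (h1 : lam < 7 / 20) : 4 / 5 < gpp lam ∧ gpp lam < 1 := by
  have hd : 0 < 1 + lam - lam ^ 2 := by nlinarith
  constructor
  · rw [gpp, lt_div_iff₀ hd]
    nlinarith [pow_pos h0 2]
  · rw [gpp, div_lt_one hd]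
    nlinarith [pow_pos h0 2]

theorem le_of_mem_corner {lam : ℝ} (h0 : 0 < lam) (h1 : lam < 7 / 20) {z : ℝ × ℝ}
    (hz : z ∈ corner lam) : g lam ≤ z.1 ∧ gpp lam ≤ z.2 := by
  obtain ⟨hz1, hz2, hz3⟩ := hz
  obtain ⟨a1, a2⟩ := g_bounds h0 h1
  obtain ⟨b1, b2⟩ := gpp_bounds h0 h1
  unfold ell at hz3
  constructor
  · by_contra! h
    nlinarith
  · by_contra! h
    nlinarith

/-! ### The dynamics -/

theorem F_eq_step {lam : ℝ} {i : ℤ} {z : ℝ × ℝ} (h0 : 0 ≤ (step lam i z).1)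
    (h1 : (step lam i z).1 < 1) : F lam z = step lam i z := by
  simp only [step] at h0 h1
  have : ⌊lam * z.1 - z.2⌋ = -i := by
    rw [Int.floor_eq_iff]
    push_cast
    constructor <;> linarith
  rw [F, iota, this, neg_neg]

theorem iterate_F_eq_orbit {lam : ℝ} {m n : ℕ} {z : ℝ × ℝ}
    (h : ∀ k, 1 ≤ k → k ≤ n → 0 ≤ (orbit lam m z k).1 ∧ (orbit lam m z k).1 < 1)
    (k : ℕ) (hk : k ≤ n) : (F lam)^[k] (G z) = orbit lam m z k := by
  induction k with
  | zero => rfl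
  | succ k ih =>
    obtain ⟨h0, h1⟩ := h (k + 1) (by omega) hk
    rw [Function.iterate_succ_apply', ih (by omega), F_eq_step h0 h1, orbit]

theorem mem_domain_iff {lam : ℝ} {z : ℝ × ℝ} :
    z ∈ domain lam ↔ z.1 < 1 ∧ z.2 < 1 ∧ 0 ≤ ell lam z := Iff.rfl

theorem ell_neg_of_fst_le {lam : ℝ} (h0 : 0 < lam) (h1 : lam < 7 / 20) {z : ℝ × ℝ}
    (hx : z.1 ≤ 1 / 2) (hy : z.2 ≤ 1) : ell lam z < 0 := by
  obtain ⟨a1, a2⟩ := g_bounds h0 h1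
  obtain ⟨b1, b2⟩ := gpp_bounds h0 h1
  unfold ell
  nlinarith

theorem ell_neg_of_snd_le {lam : ℝ} (h0 : 0 < lam) (h1 : lam < 7 / 20) {z : ℝ × ℝ}
    (hx : z.1 ≤ 1) (hy : z.2 ≤ 1 / 2) : ell lam z < 0 := by
  obtain ⟨a1, a2⟩ := g_bounds h0 h1
  obtain ⟨b1, b2⟩ := gpp_bounds h0 h1
  unfold ell
  nlinarith

/-- Times 1 and $4m+2$ escape the $1/2$ bounds of `admissible`. Here $1+\lambda<2g$ puts the first
image to the left of the whole triangle. -/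
theorem ell_first_neg {lam : ℝ} (h0 : 0 < lam) (h1 : lam < 7 / 20) {z : ℝ × ℝ}
    (hz : z ∈ corner lam) : ell lam (lam * z.2 - z.1 + 1, z.2) < 0 := by
  obtain ⟨a1, a2⟩ := g_bounds h0 h1
  obtain ⟨b1, b2⟩ := gpp_bounds h0 h1
  obtain ⟨c1, c2⟩ := le_of_mem_corner h0 h1 hz
  have hy := hz.2.1
  simp only [ell]
  have : lam * z.2 - z.1 + 1 - g lam < 0 := by nlinarith
  nlinarith

/-- The point at time $4m+2$ is the reflection of the first image of `ret lam m z`. Bounding both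
coordinates gives $(1-g)(1+\lambda-g-g'')$, which is negative. -/
theorem ell_last_neg {lam : ℝ} (h0 : 0 < lam) (h1 : lam < 7 / 20) {z : ℝ × ℝ}
    (hz : z ∈ corner lam) : ell lam (z.2, lam * z.2 - z.1 + 1) < 0 := by
  obtain ⟨a1, a2⟩ := g_bounds h0 h1
  obtain ⟨b1, b2⟩ := gpp_bounds h0 h1
  obtain ⟨c1, c2⟩ := le_of_mem_corner h0 h1 hz
  have hy := hz.2.1
  have hs : 1 + lam < g lam + gpp lam := by nlinarith
  simp only [ell]
  have e1 : (1 - gpp lam) * (z.2 - g lam) ≤ (1 - gpp lam) * (1 - g lam) := by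
    apply mul_le_mul_of_nonneg_left <;> linarith
  have e2 : (1 - g lam) * (lam * z.2 - z.1 + 1 - 1) ≤ (1 - g lam) * (lam - g lam) := by
    apply mul_le_mul_of_nonneg_left
    · nlinarith
    · linarith
  nlinarith

theorem orbit_one (lam : ℝ) (m : ℕ) (z : ℝ × ℝ) :
    orbit lam m z 1 = (lam * z.2 - z.1 + 1, z.2) := by
  simp [orbit, symbol, step, G]

theorem orbit_last (lam : ℝ) (m : ℕ) (z : ℝ × ℝ) :
    orbit lam m z (4 * m + 2) =
      ((ret lam m z).2, lam * (ret lam m z).2 - (ret lam m z).1 + 1) := by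
  have h := orbit_ret lam m (ret lam m z) (4 * m + 2) (by omega)
  rw [ret_ret, show 4 * m + 3 - (4 * m + 2) = 1 by omega, orbit_one] at h
  exact h

theorem orbit_bounds {lam : ℝ} (h0 : 0 < lam) (h1 : lam < 7 / 20) {m : ℕ} {z : ℝ × ℝ}
    (hz : z ∈ admissible lam m) (hz2 : ret lam m z ∈ domain lam)
    (k : ℕ) (hk1 : 1 ≤ k) (hk : k ≤ 4 * m + 3) :
    0 ≤ (orbit lam m z k).1 ∧ (orbit lam m z k).1 < 1 := by
  obtain ⟨c1, c2⟩ := le_of_mem_corner h0 h1 hz.2.1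
  have a1 := (g_bounds h0 h1).1
  have b1 := (gpp_bounds h0 h1).1
  rcases Nat.lt_or_ge (4 * m + 1) k with h | h
  · obtain rfl | rfl : k = 4 * m + 2 ∨ k = 4 * m + 3 := by omega
    · rw [orbit_last]
      exact ⟨by dsimp only; linarith, hz2.2.1⟩
    · exact ⟨by change 0 ≤ (ret lam m z).1; linarith, hz2.1⟩
  · exact ⟨(hz.2.2 k hk1 h).1, (hz.2.2 k hk1 h).2.1⟩

theorem orbit_notMem_domain {lam : ℝ} (h0 : 0 < lam) (h1 : lam < 7 / 20) {m : ℕ} {z : ℝ × ℝ}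
    (hz : z ∈ admissible lam m) (k : ℕ) (hk1 : 1 ≤ k) (hk : k ≤ 4 * m + 2) :
    orbit lam m z k ∉ domain lam := by
  intro hd
  rw [mem_domain_iff] at hd
  suffices ell lam (orbit lam m z k) < 0 by linarith [hd.2.2]
  by_cases hk2 : k = 1
  · rw [hk2, orbit_one]
    exact ell_first_neg h0 h1 hz.1
  by_cases hk3 : k = 4 * m + 2
  · rw [hk3, orbit_last]
    exact ell_last_neg h0 h1 hz.2.1
  -- Every remaining point has a coordinate at most $1/2$: the abscissa at even times, and at odd
  -- times the ordinate, which is the preceding abscissa.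
  rcases Nat.mod_two_eq_zero_or_one k with hp | hp
  · exact ell_neg_of_fst_le h0 h1 ((hz.2.2 k hk1 (by omega)).2.2 hp) hd.2.1.le
  · apply ell_neg_of_snd_le h0 h1 hd.1.le
    obtain ⟨j, rfl⟩ : ∃ j, k = j + 1 := ⟨k - 1, by omega⟩
    rw [orbit_succ_snd]
    exact (hz.2.2 j (by omega) (by omega)).2.2 (by omega)

theorem isLeast_returnTimes {lam : ℝ} (h0 : 0 < lam) (h1 : lam < 7 / 20) {m : ℕ} {z : ℝ × ℝ}
    (hz : z ∈ admissible lam m) (hz2 : ret lam m z ∈ domain lam) :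
    IsLeast (returnTimes lam z) (4 * m + 3) := by
  have key := iterate_F_eq_orbit (orbit_bounds h0 h1 hz hz2)
  constructor
  · refine ⟨by omega, ?_⟩
    rw [key _ le_rfl]
    exact hz2
  · rintro k ⟨hk1, hk2⟩
    by_contra! hlt
    rw [key k (by omega)] at hk2
    exact orbit_notMem_domain h0 h1 hz k hk1 (by omega) hk2

/-! ### Affine functions on open sets -/

/-- A nonconstant affine function has no minimum on an open set: a small step against the gradient
would make it negative. -/
theorem pos_of_nonneg_of_isOpen {U : Set (ℝ × ℝ)} (hU : IsOpen U) {a b c : ℝ}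
    (hab : a ≠ 0 ∨ b ≠ 0) (h : ∀ z ∈ U, 0 ≤ a * z.1 + b * z.2 + c) {z : ℝ × ℝ} (hz : z ∈ U) :
    0 < a * z.1 + b * z.2 + c := by
  have hpos : 0 < a ^ 2 + b ^ 2 := by
    rcases hab with h | h <;> positivity
  have hc : Continuous fun t : ℝ => ((z.1 - t * a, z.2 - t * b) : ℝ × ℝ) := by fun_prop
  have hev : ∀ᶠ t in nhds (0 : ℝ), ((z.1 - t * a, z.2 - t * b) : ℝ × ℝ) ∈ U :=
    hc.continuousAt.eventually (by simpa using hU.mem_nhds hz)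
  obtain ⟨ε, hε, hball⟩ := Metric.eventually_nhds_iff.1 hev
  have hm := h _ (hball (y := ε / 2) (by
    rw [Real.dist_eq, sub_zero, abs_of_pos (by positivity)]
    linarith))
  simp only at hm
  nlinarith

theorem interior_corner_strict {lam : ℝ} (h0 : 0 < lam) (h1 : lam < 7 / 20) {H : Set (ℝ × ℝ)}
    (hH : H ⊆ corner lam) {z : ℝ × ℝ} (hz : z ∈ interior H) :
    z.1 < 1 ∧ z.2 < 1 ∧ 0 < ell lam z := by
  have hc : ∀ w ∈ interior H, w ∈ corner lam := fun w hw => hH (interior_subset hw)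
  refine ⟨?_, ?_, ?_⟩
  · have := pos_of_nonneg_of_isOpen isOpen_interior (a := -1) (b := 0) (c := 1) (by norm_num)
      (fun w hw => by linarith [(hc w hw).1]) hz
    linarith
  · have := pos_of_nonneg_of_isOpen isOpen_interior (a := 0) (b := -1) (c := 1) (by norm_num)
      (fun w hw => by linarith [(hc w hw).2.1]) hz
    linarith
  · have e : ∀ w, ell lam w = (1 - gpp lam) * w.1 + (1 - g lam) * w.2
        + (-(1 - gpp lam) * g lam - (1 - g lam)) := fun w => by
      unfold ell
      ring
    rw [e]
    refine pos_of_nonneg_of_isOpen isOpen_interior (Or.inr ?_)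
      (fun w hw => by rw [← e]; exact (hc w hw).2.2) hz
    linarith [(g_bounds h0 h1).2]

/-! ### Symmetric convex polygons -/

/-- `ret` as an affine map. -/
noncomputable def retAffine (lam : ℝ) (m : ℕ) : (ℝ × ℝ) →ᵃ[ℝ] (ℝ × ℝ) :=
  AffineMap.ofMapMidpoint (ret lam m)
    (fun x y => by
      rw [midpoint_eq_smul_add, midpoint_eq_smul_add, smul_add, smul_add]
      exact orbit_combo _ _ _ _ _ _ (by norm_num) _)
    (continuous_orbit lam m _)

theorem coe_retAffine (lam : ℝ) (m : ℕ) : ⇑(retAffine lam m) = ret lam m := rfl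

theorem image_ret_convexHull {lam : ℝ} {m : ℕ} {S : Set (ℝ × ℝ)}
    (hR : ∀ v ∈ S, ret lam m v ∈ S) :
    ret lam m '' convexHull ℝ S = convexHull ℝ S := by
  have hS : ret lam m '' S = S := by
    apply Set.Subset.antisymm
    · rintro _ ⟨v, hv, rfl⟩
      exact hR v hv
    · intro v hv
      exact ⟨_, hR v hv, ret_ret _ _ _⟩
  rw [← coe_retAffine, AffineMap.image_convexHull, coe_retAffine, hS]

theorem image_ret_interior_convexHull {lam : ℝ} {m : ℕ} {S : Set (ℝ × ℝ)}
    (hR : ∀ v ∈ S, ret lam m v ∈ S) :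
    ret lam m '' interior (convexHull ℝ S) = interior (convexHull ℝ S) := by
  have := (retHomeo lam m).image_interior (convexHull ℝ S)
  change ret lam m '' _ = interior (ret lam m '' _) at this
  rw [this, image_ret_convexHull hR]

/-- The map $z\mapsto$ midpoint of $z$ and `ret lam m z` is affine, so the preimage of a convex set
is convex. -/
theorem midpoint_ret_mem {lam : ℝ} {m : ℕ} {S T : Set (ℝ × ℝ)} (hT : Convex ℝ T)
    (hmid : ∀ v ∈ S, midpoint ℝ v (ret lam m v) ∈ T) {z : ℝ × ℝ} (hz : z ∈ convexHull ℝ S) :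
    midpoint ℝ z (ret lam m z) ∈ T := by
  have hconv : Convex ℝ {w | midpoint ℝ w (ret lam m w) ∈ T} := by
    intro w hw v hv a b ha hb hab
    have e : midpoint ℝ (a • w + b • v) (ret lam m (a • w + b • v)) =
        a • midpoint ℝ w (ret lam m w) + b • midpoint ℝ v (ret lam m v) := by
      rw [ret, orbit_combo _ _ _ _ _ _ hab]
      simp only [midpoint_eq_smul_add, ret]
      module
    change _ ∈ T
    rw [e]
    exact hT hw hv ha hb hab
  exact convexHull_min hmid hconv hz

/-- The fixed set of `ret` in the convex hull of an invariant set of vertices. -/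
theorem fixed_convexHull {lam : ℝ} {m : ℕ} {S : Set (ℝ × ℝ)} {P Q : ℝ × ℝ}
    (hmid : ∀ v ∈ S, midpoint ℝ v (ret lam m v) ∈ segment ℝ P Q)
    (hP : P ∈ S) (hQ : Q ∈ S) (hPf : ret lam m P = P) (hQf : ret lam m Q = Q) :
    {z | z ∈ convexHull ℝ S ∧ ret lam m z = z} = segment ℝ P Q := by
  apply Set.Subset.antisymm
  · rintro z ⟨hz, hf⟩
    have := midpoint_ret_mem (convex_segment P Q) hmid hz
    rwa [hf, midpoint_self] at this
  · rintro z hz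
    refine ⟨(convex_convexHull ℝ S).segment_subset (subset_convexHull ℝ S hP)
      (subset_convexHull ℝ S hQ) hz, ?_⟩
    obtain ⟨a, b, ha, hb, hab, rfl⟩ := hz
    have : ret lam m (a • P + b • Q) = a • ret lam m P + b • ret lam m Q :=
      orbit_combo _ _ _ _ _ _ hab _
    rw [this, hPf, hQf]

theorem fixed_interior_convexHull {lam : ℝ} {m : ℕ} {S : Set (ℝ × ℝ)} {P Q : ℝ × ℝ}
    (hR : ∀ v ∈ S, ret lam m v ∈ S)
    (hmid : ∀ v ∈ S, midpoint ℝ v (ret lam m v) ∈ segment ℝ P Q)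
    (hP : P ∈ S) (hQ : Q ∈ S) (hPf : ret lam m P = P) (hQf : ret lam m Q = Q)
    (hP' : P ∉ interior (convexHull ℝ S)) (hQ' : Q ∉ interior (convexHull ℝ S))
    (hne : (interior (convexHull ℝ S)).Nonempty) :
    {z | z ∈ interior (convexHull ℝ S) ∧ ret lam m z = z} = openSegment ℝ P Q := by
  have hfix := fixed_convexHull hmid hP hQ hPf hQf
  have hcv := convex_convexHull ℝ S
  have hPH := subset_convexHull ℝ S hP
  have hQH := subset_convexHull ℝ S hQ
  apply Set.Subset.antisymm
  · rintro z ⟨hz, hf⟩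
    have hzs : z ∈ segment ℝ P Q := hfix ▸ ⟨interior_subset hz, hf⟩
    rcases hzs with ⟨a, b, ha, hb, hab, rfl⟩
    refine ⟨a, b, ha.lt_of_ne ?_, hb.lt_of_ne ?_, hab, rfl⟩
    · rintro rfl
      obtain rfl : b = 1 := by linarith
      apply hQ'
      simpa using hz
    · rintro rfl
      obtain rfl : a = 1 := by linarith
      apply hP'
      simpa using hz
  -- The midpoint of an interior point and its image is an interior fixed point, so it lies on the
  -- segment. The open segments joining it to $P$ and $Q$ are interior too.
  · obtain ⟨p, hp⟩ := hne
    have hp2 : ret lam m p ∈ interior (convexHull ℝ S) :=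
      image_ret_interior_convexHull hR ▸ Set.mem_image_of_mem _ hp
    have hr : midpoint ℝ p (ret lam m p) ∈ interior (convexHull ℝ S) := by
      rw [midpoint_eq_smul_add, smul_add]
      exact hcv.interior hp hp2 (by norm_num) (by norm_num) (by norm_num)
    have hrs := midpoint_ret_mem (convex_segment P Q) hmid (interior_subset hp)
    set r := midpoint ℝ p (ret lam m p)
    intro z hz
    refine ⟨?_, (hfix.symm ▸ openSegment_subset_segment ℝ P Q hz :
      z ∈ {z | z ∈ convexHull ℝ S ∧ ret lam m z = z}).2⟩
    rw [segment_eq_image_lineMap] at hrs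
    rcases openSegment_subset_union P Q (Set.image_subset_range _ _ hrs) hz with rfl | h | h
    · exact hr
    · exact hcv.openSegment_closure_interior_subset_interior (subset_closure hPH) hr h
    · exact hcv.openSegment_interior_closure_subset_interior hr (subset_closure hQH) h

theorem interior_convexHull_nonempty_of_triangle {S : Set (ℝ × ℝ)} {a b c y : ℝ}
    (hab : a ≠ b) (hy : y ≠ 1) (h1 : (a, 1) ∈ S) (h2 : (b, 1) ∈ S) (h3 : (c, y) ∈ S) :
    (interior (convexHull ℝ S)).Nonempty := by
  have hab' : b - a ≠ 0 := sub_ne_zero.2 hab.symm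
  have hy' : y - 1 ≠ 0 := sub_ne_zero.2 hy
  -- `s` and `t` are the barycentric coordinates at the second and third corners. Points with all
  -- three coordinates positive form an open subset of the hull, and the centroid is one of them.
  set t : ℝ × ℝ → ℝ := fun w => (w.2 - 1) / (y - 1) with ht
  set s : ℝ × ℝ → ℝ := fun w => (w.1 - a - t w * (c - a)) / (b - a) with hs
  have htc : Continuous t := by fun_prop
  have hsc : Continuous s := by fun_prop
  have hopen : IsOpen {w | 0 < t w ∧ 0 < s w ∧ s w + t w < 1} :=
    (isOpen_lt continuous_const htc).inter
      ((isOpen_lt continuous_const hsc).inter (isOpen_lt (hsc.add htc) continuous_const))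
  refine ⟨((a + b + c) / 3, (1 + 1 + y) / 3), mem_interior.2 ⟨_, ?_, hopen, ?_⟩⟩
  · rintro w ⟨w1, w2, w3⟩
    have hcv := convex_convexHull ℝ S
    have hsub := subset_convexHull ℝ S
    have h1t : 0 < 1 - t w := by linarith
    have hAB := hcv (hsub h1) (hsub h2) (a := (1 - s w - t w) / (1 - t w)) (b := s w / (1 - t w))
      (div_nonneg (by linarith) h1t.le) (div_nonneg w2.le h1t.le) (by field_simp; ring)
    have hABC := hcv hAB (hsub h3) h1t.le w1.le (by ring)
    convert hABC using 1
    have e1 : t w * (y - 1) = w.2 - 1 := by rw [ht]; field_simp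
    have e2 : s w * (b - a) = w.1 - a - t w * (c - a) := by rw [hs]; field_simp
    ext
    · simp only [Prod.fst_add, Prod.smul_fst, smul_eq_mul]
      field_simp
      linear_combination -e2
    · simp only [Prod.snd_add, Prod.smul_snd, smul_eq_mul]
      field_simp
      linear_combination -e1
  · have e1 : t ((a + b + c) / 3, (1 + 1 + y) / 3) = 1 / 3 := by
      simp only [ht]
      field_simp
      ring
    have e2 : s ((a + b + c) / 3, (1 + 1 + y) / 3) = 1 / 3 := by
      simp only [hs, e1]
      field_simp
      ring
    change 0 < t _ ∧ 0 < s _ ∧ s _ + t _ < 1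
    rw [e1, e2]
    norm_num

/-- The properties of an outer atom that follow from the combinatorics of its vertices. -/
theorem outer_atom {lam : ℝ} (h0 : 0 < lam) (h1 : lam < 7 / 20) {m : ℕ} (hm : 1 ≤ m)
    {S : Set (ℝ × ℝ)} {P Q : ℝ × ℝ} (hS : S ⊆ admissible lam m)
    (hR : ∀ v ∈ S, ret lam m v ∈ S)
    (hmid : ∀ v ∈ S, midpoint ℝ v (ret lam m v) ∈ segment ℝ P Q)
    (hP : P ∈ S) (hQ : Q ∈ S) (hPf : ret lam m P = P) (hQf : ret lam m Q = Q)
    (hP1 : P.2 = 1) (hQ1 : Q.1 = 1 ∨ ell lam Q = 0)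
    (hne : (interior (convexHull ℝ S)).Nonempty) :
    interior (convexHull ℝ S) ⊆ LoutDomain lam ∧
    Set.EqOn (Lout lam) ((F lam)^[4 * m + 3] ∘ G) (interior (convexHull ℝ S)) ∧
    Set.EqOn ((F lam)^[4 * m + 3] ∘ G) (codeMap lam (outCode m) ∘ G)
      (interior (convexHull ℝ S)) ∧
    (Lout lam '' interior (convexHull ℝ S) =
        ((F lam)^[4 * m + 3] ∘ G) '' interior (convexHull ℝ S) ∧
      ((F lam)^[4 * m + 3] ∘ G) '' interior (convexHull ℝ S) =
        (codeMap lam (outCode m) ∘ G) '' interior (convexHull ℝ S) ∧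
      (codeMap lam (outCode m) ∘ G) '' interior (convexHull ℝ S) =
        interior (convexHull ℝ S)) ∧
    {z | z ∈ interior (convexHull ℝ S) ∧ Lout lam z = z} = openSegment ℝ P Q ∧
    {z | z ∈ convexHull ℝ S ∧ codeMap lam (outCode m) (G z) = z} = segment ℝ P Q := by
  have hH : convexHull ℝ S ⊆ admissible lam m := convexHull_min hS (convex_admissible lam m)
  have hstrict : ∀ z ∈ interior (convexHull ℝ S), z.1 < 1 ∧ z.2 < 1 ∧ 0 < ell lam z :=
    fun z hz => interior_corner_strict h0 h1 (fun w hw => (hH hw).1) hz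
  have himg := image_ret_interior_convexHull hR
  have hdom : ∀ z ∈ interior (convexHull ℝ S), z ∈ domain lam := fun z hz =>
    ⟨(hstrict z hz).1, (hstrict z hz).2.1, (hstrict z hz).2.2.le⟩
  have hdom2 : ∀ z ∈ interior (convexHull ℝ S), ret lam m z ∈ domain lam := fun z hz =>
    hdom _ (himg ▸ Set.mem_image_of_mem _ hz)
  have hadm : ∀ z ∈ interior (convexHull ℝ S), z ∈ admissible lam m := fun z hz =>
    hH (interior_subset hz)
  have hleast := fun z hz => isLeast_returnTimes h0 h1 (hadm z hz) (hdom2 z hz)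
  have hcode : codeMap lam (outCode m) ∘ G = ret lam m :=
    funext fun z => codeMap_outCode lam m hm z
  have hE1 : Set.EqOn (Lout lam) ((F lam)^[4 * m + 3] ∘ G) (interior (convexHull ℝ S)) := by
    intro z hz
    rw [Lout, (hleast z hz).csInf_eq]
    rfl
  have hE2 : Set.EqOn ((F lam)^[4 * m + 3] ∘ G) (codeMap lam (outCode m) ∘ G)
      (interior (convexHull ℝ S)) := by
    intro z hz
    rw [hcode]
    exact iterate_F_eq_orbit (orbit_bounds h0 h1 (hadm z hz) (hdom2 z hz)) _ le_rfl
  refine ⟨fun z hz => ⟨hdom z hz, _, (hleast z hz).1⟩, hE1, hE2,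
    ⟨hE1.image_eq, hE2.image_eq, by rw [hcode, himg]⟩, ?_, ?_⟩
  · rw [← fixed_interior_convexHull hR hmid hP hQ hPf hQf _ _ hne]
    · ext z
      refine and_congr_right fun hz => ?_
      rw [hE1 hz, hE2 hz, hcode]
    · intro h
      -- The end-points of the segment lie on the sides of the triangle, where interior points
      -- cannot be.
      linarith [(hstrict _ h).2.1]
    · intro h
      rcases hQ1 with hQ1 | hQ1 <;> linarith [(hstrict _ h).1, (hstrict _ h).2.2]
  · rw [← fixed_convexHull hmid hP hQ hPf hQf]
    simp only [codeMap_outCode lam m hm]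

open Real

/-! ### Sinusoidal orbits -/

/-- The value around which the even (`j` even) and odd terms of an orbit oscillate. -/
noncomputable def center (lam : ℝ) (j : ℕ) : ℝ :=
  (if j % 2 = 0 then 2 else lam) / (4 - lam ^ 2)

/-- The deviation of an orbit with code `outCode m` from a sinusoid, at its ends. -/
noncomputable def bump (lam : ℝ) (m j : ℕ) : ℝ :=
  if j = 1 ∨ j = 4 * m + 3 then 1 else if j = 0 ∨ j = 4 * m + 4 then lam else 0

/-- The orbit with code `outCode m` and amplitude `A`, with phase zero `c` steps after the
middle. -/
noncomputable def wave (lam θ : ℝ) (m : ℕ) (A c : ℝ) (j : ℕ) : ℝ :=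
  center lam j + A * cos (((j : ℝ) - (2 * m + 2) - c) * (π / 2 - θ)) + bump lam m j

/-- The end-points of sinusoidal orbits. -/
noncomputable def wavePoint (lam θ A k : ℝ) : ℝ × ℝ :=
  (2 / (4 - lam ^ 2) + lam + A * cos ((k + 1) * (π / 2 - θ)),
    lam / (4 - lam ^ 2) + 1 + A * cos (k * (π / 2 - θ)))

/-- The amplitude of the sinusoid that vanishes at the odd position `2 * i + 1`. -/
noncomputable def amp (lam θ : ℝ) (i : ℕ) : ℝ :=
  -((-1) ^ i * (lam / (4 - lam ^ 2) / sin ((2 * i + 1) * θ)))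

theorem center_add {lam : ℝ} (hd : 4 - lam ^ 2 ≠ 0) (k : ℕ) :
    center lam (k + 2) = lam * center lam (k + 1) - center lam k + if k % 2 = 0 then 1 else 0 := by
  unfold center
  rcases Nat.mod_two_eq_zero_or_one k with h | h
  · rw [if_pos (by omega), if_neg (by omega), if_pos h, if_pos h]
    field_simp
    ring
  · rw [if_neg (by omega), if_pos (by omega), if_neg (by omega), if_neg (by omega)]
    field_simp
    ring

/-- The two extra symbols occur at times $1$ and $4m+1$. The end values $\lambda,1$ and $1,\lambda$
absorb them exactly, so the correction vanishes throughout the middle. -/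
theorem bump_add (lam : ℝ) {m : ℕ} (hm : 1 ≤ m) {k : ℕ} (hk : k < 4 * m + 3) :
    bump lam m (k + 2) =
      lam * bump lam m (k + 1) - bump lam m k + if k = 1 ∨ k = 4 * m + 1 then 1 else 0 := by
  by_cases h0 : k = 0
  · subst h0
    simp [bump]
  by_cases h1 : k = 1
  · subst h1
    have h2 : ¬ (m = 0) := by omega
    simp [bump, h2]
  by_cases h2 : k = 4 * m + 1
  · subst h2
    have h2 : ¬ (m = 0) := by omega
    simp [bump, h2]
  by_cases h3 : k = 4 * m + 2
  · subst h3
    simp [bump]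
  unfold bump
  rw [if_neg (by omega), if_neg (by omega), if_neg (by omega), if_neg (by omega),
    if_neg (by omega), if_neg (by omega), if_neg (by omega)]
  ring

theorem symbol_eq_add {m k : ℕ} :
    (symbol m k : ℝ) =
      (if k % 2 = 0 then 1 else 0) + if k = 1 ∨ k = 4 * m + 1 then 1 else 0 := by
  unfold symbol
  split_ifs <;> first | omega | simp

theorem wave_add {lam θ : ℝ} (hs : sin θ = lam / 2) (hd : 4 - lam ^ 2 ≠ 0) {m : ℕ} (hm : 1 ≤ m)
    (A c : ℝ) (k : ℕ) (hk : k < 4 * m + 3) :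
    wave lam θ m A c (k + 2) =
      lam * wave lam θ m A c (k + 1) - wave lam θ m A c k + symbol m k := by
  have hcos : cos ((((k + 2 : ℕ) : ℝ) - (2 * m + 2) - c) * (π / 2 - θ)) =
      lam * cos ((((k + 1 : ℕ) : ℝ) - (2 * m + 2) - c) * (π / 2 - θ)) -
        cos (((k : ℝ) - (2 * m + 2) - c) * (π / 2 - θ)) := by
    have e1 : (((k + 2 : ℕ) : ℝ) - (2 * m + 2) - c) * (π / 2 - θ) =
      (((k + 1 : ℕ) : ℝ) - (2 * m + 2) - c) * (π / 2 - θ) + (π / 2 - θ) := by push_cast; ring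
    have e2 : ((k : ℝ) - (2 * m + 2) - c) * (π / 2 - θ) =
      (((k + 1 : ℕ) : ℝ) - (2 * m + 2) - c) * (π / 2 - θ) - (π / 2 - θ) := by push_cast; ring
    have e3 : cos (π / 2 - θ) = lam / 2 := by rw [cos_pi_div_two_sub, hs]
    rw [e1, e2, cos_add _ (π / 2 - θ), cos_sub _ (π / 2 - θ), e3]
    ring
  simp only [wave]
  rw [hcos, center_add hd, bump_add lam hm hk, symbol_eq_add]
  ring

theorem orbit_wavePoint {lam θ : ℝ} (hs : sin θ = lam / 2) (hd : 4 - lam ^ 2 ≠ 0) {m : ℕ}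
    (hm : 1 ≤ m) (A c : ℝ) {k : ℕ} (hk : k ≤ 4 * m + 3) :
    orbit lam m (wavePoint lam θ A (2 * m + 1 + c)) k =
      (wave lam θ m A c (k + 1), wave lam θ m A c k) := by
  rw [← orbit_eq_of_recurrence lam m (wave lam θ m A c) _ (wave_add hs hd hm A c) k hk]
  congr 1
  ext
  · have e : cos ((((0 : ℕ) : ℝ) - (2 * m + 2) - c) * (π / 2 - θ)) =
        cos ((2 * m + 1 + c + 1) * (π / 2 - θ)) := by
      rw [← cos_neg]
      congr 1
      push_cast
      ring
    simp only [wave, wavePoint, center, bump, e]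
    norm_num
    ring
  · have e : cos ((((1 : ℕ) : ℝ) - (2 * m + 2) - c) * (π / 2 - θ)) =
        cos ((2 * m + 1 + c) * (π / 2 - θ)) := by
      rw [← cos_neg]
      congr 1
      push_cast
      ring
    simp only [wave, wavePoint, center, bump, e]
    norm_num
    ring

/-- The sinusoid is even about its phase origin: reversing the orbit changes the offset $c$ into
$-c$. Offset 0 gives fixed points. -/
theorem ret_wavePoint {lam θ : ℝ} (hs : sin θ = lam / 2) (hd : 4 - lam ^ 2 ≠ 0) {m : ℕ}
    (hm : 1 ≤ m) (A c : ℝ) :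
    ret lam m (wavePoint lam θ A (2 * m + 1 + c)) = wavePoint lam θ A (2 * m + 1 - c) := by
  rw [ret, orbit_wavePoint hs hd hm A c le_rfl]
  have h1 : (4 * m + 3 + 1) % 2 = 0 := by omega
  have h2 : ¬ (4 * m + 3) % 2 = 0 := by omega
  have h3 : ¬ (4 * m + 3 + 1 = 1 ∨ 4 * m + 3 + 1 = 4 * m + 3) := by omega
  ext
  · simp only [wave, wavePoint, center, bump]
    rw [if_pos h1, if_neg h3]
    push_cast
    norm_num
    ring_nf
  · simp only [wave, wavePoint, center, bump]
    rw [if_neg h2]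
    push_cast
    norm_num
    ring_nf

theorem cos_odd_mul (θ : ℝ) (j : ℕ) :
    cos ((2 * j + 1) * (π / 2 - θ)) = (-1) ^ j * sin ((2 * j + 1) * θ) := by
  rw [show (2 * (j : ℝ) + 1) * (π / 2 - θ) = (π / 2 - (2 * j + 1) * θ) + j * π by ring,
    cos_add_nat_mul_pi, cos_pi_div_two_sub]

theorem cos_even_mul (θ : ℝ) (j : ℕ) :
    cos ((2 * j) * (π / 2 - θ)) = (-1) ^ j * cos ((2 * j) * θ) := by
  rw [show (2 * (j : ℝ)) * (π / 2 - θ) = (-((2 * j) * θ)) + j * π by ring,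
    cos_add_nat_mul_pi, cos_neg]

theorem sin_three (θ : ℝ) : sin (3 * θ) = sin θ * (3 - 4 * sin θ ^ 2) := by
  rw [sin_three_mul]
  ring

theorem sin_odd_pos {θ : ℝ} (hθ : 0 < θ) {i : ℕ} (hi : (2 * i + 1) * θ ≤ π / 2) :
    0 < sin ((2 * i + 1) * θ) :=
  sin_pos_of_pos_of_lt_pi (by positivity) (by linarith [pi_pos])

theorem sin_three_le {θ : ℝ} (hθ : 0 < θ) {i : ℕ} (hi1 : 1 ≤ i) (hi : (2 * i + 1) * θ ≤ π / 2) :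
    sin (3 * θ) ≤ sin ((2 * i + 1) * θ) := by
  have : (1 : ℝ) ≤ i := by exact_mod_cast hi1
  apply sin_le_sin_of_le_of_le_pi_div_two _ hi
  · nlinarith
  · nlinarith [pi_pos]

theorem abs_amp_le {lam θ : ℝ} (hs : sin θ = lam / 2) (h0 : 0 < lam) (h1 : lam < 7 / 20)
    (hθ : 0 < θ) {i : ℕ} (hi1 : 1 ≤ i) (hi : (2 * i + 1) * θ ≤ π / 2) :
    |amp lam θ i| ≤ 2 / ((4 - lam ^ 2) * (3 - lam ^ 2)) := by
  have hd : 0 < 4 - lam ^ 2 := by nlinarith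
  have hd3 : 0 < 3 - lam ^ 2 := by nlinarith
  have h3 := sin_three_le hθ hi1 hi
  have hp := sin_odd_pos hθ hi
  rw [sin_three, hs] at h3
  rw [amp, abs_neg, abs_mul, abs_pow, abs_neg, abs_one, one_pow, one_mul,
    abs_of_pos (by positivity), div_div, div_le_div_iff₀ (by positivity) (by positivity)]
  have : lam * (3 - lam ^ 2) ≤ 2 * sin ((2 * i + 1) * θ) := by nlinarith
  nlinarith

theorem amp_mul_cos {lam θ : ℝ} (i j : ℕ) :
    amp lam θ i * cos ((2 * j + 1) * (π / 2 - θ)) =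
      -((-1) ^ (i + j) * (lam / (4 - lam ^ 2) *
        (sin ((2 * j + 1) * θ) / sin ((2 * i + 1) * θ)))) := by
  rw [cos_odd_mul, amp, pow_add]
  ring

/-- With $x=\lambda/(4-\lambda^2)\le 1/8$, the term is $x(1\pm r)$ with $r$ a quotient of sines. Up
to the zero of the sinusoid $r\le1$; one place beyond it the sign is plus and $r\le3$, so the term
is at most $4x\le1/2$. -/
theorem odd_term_bounds {lam θ : ℝ} (hs : sin θ = lam / 2) (h0 : 0 < lam) (h1 : lam < 7 / 20)
    (hθ : 0 < θ) {i : ℕ} (hi : (2 * i + 1) * θ ≤ π / 2) {j : ℕ}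
    (hj : j ≤ i ∨ (j = i + 1 ∧ (2 * i + 3) * θ ≤ π / 2)) :
    0 ≤ lam / (4 - lam ^ 2) + amp lam θ i * cos ((2 * j + 1) * (π / 2 - θ)) ∧
      lam / (4 - lam ^ 2) + amp lam θ i * cos ((2 * j + 1) * (π / 2 - θ)) ≤ 1 / 2 := by
  have hd : 0 < 4 - lam ^ 2 := by nlinarith
  have hp := sin_odd_pos hθ hi
  have hco : lam / (4 - lam ^ 2) ≤ 1 / 8 := by
    rw [div_le_div_iff₀ hd (by norm_num)]
    nlinarith
  have hco0 : 0 < lam / (4 - lam ^ 2) := by positivity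
  rw [amp_mul_cos]
  set x := lam / (4 - lam ^ 2)
  rcases hj with hj | ⟨rfl, hj⟩
  · have hj' : (j : ℝ) ≤ i := by exact_mod_cast hj
    have hr0 : 0 ≤ sin ((2 * j + 1) * θ) / sin ((2 * i + 1) * θ) := by
      apply div_nonneg _ hp.le
      exact (sin_odd_pos hθ (by nlinarith)).le
    have hr1 : sin ((2 * j + 1) * θ) / sin ((2 * i + 1) * θ) ≤ 1 := by
      rw [div_le_one hp]
      apply sin_le_sin_of_le_of_le_pi_div_two _ hi
      · nlinarith
      · have : 0 ≤ (2 * (j : ℝ) + 1) * θ := by positivity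
        linarith [pi_pos]
    have hle : x * (sin ((2 * j + 1) * θ) / sin ((2 * i + 1) * θ)) ≤ x :=
      mul_le_of_le_one_right hco0.le hr1
    have hge : 0 ≤ x * (sin ((2 * j + 1) * θ) / sin ((2 * i + 1) * θ)) := by positivity
    rcases neg_one_pow_eq_or ℝ (i + j) with h | h <;> rw [h] <;> constructor <;> linarith
  · have hsign : ((-1 : ℝ)) ^ (i + (i + 1)) = -1 := Odd.neg_one_pow ⟨i, by ring⟩
    rw [hsign]
    have hp1 : 0 ≤ sin ((2 * (i + 1 : ℕ) + 1) * θ) := by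
      refine (sin_odd_pos hθ ?_).le
      push_cast
      linarith
    have hp3 : sin ((2 * (i + 1 : ℕ) + 1) * θ) ≤ 3 * sin ((2 * i + 1) * θ) := by
      have e : (2 * ((i + 1 : ℕ) : ℝ) + 1) * θ = (2 * i + 1) * θ + 2 * θ := by push_cast; ring
      have hsθ : sin θ ≤ sin ((2 * i + 1) * θ) := by
        apply sin_le_sin_of_le_of_le_pi_div_two _ hi
        · nlinarith [(Nat.cast_nonneg i : (0 : ℝ) ≤ i)]
        · linarith [pi_pos]
      have hsθ0 : 0 < sin θ := by rw [hs]; linarith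
      rw [e, sin_add, sin_two_mul]
      have a1 : sin ((2 * i + 1) * θ) * cos (2 * θ) ≤ sin ((2 * i + 1) * θ) :=
        mul_le_of_le_one_right hp.le (cos_le_one _)
      have a2 : cos ((2 * i + 1) * θ) * (2 * sin θ * cos θ) ≤ 2 * sin θ * 1 := by
        have c0 : 0 ≤ cos θ := by
          apply cos_nonneg_of_neg_pi_div_two_le_of_le
          · linarith [pi_pos]
          · nlinarith [(Nat.cast_nonneg i : (0 : ℝ) ≤ i)]
        have : 2 * sin θ * cos θ ≤ 2 * sin θ * 1 := by
          apply mul_le_mul_of_nonneg_left (cos_le_one _)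
          linarith
        have h2 : cos ((2 * i + 1) * θ) * (2 * sin θ * cos θ) ≤ 1 * (2 * sin θ * cos θ) := by
          apply mul_le_mul_of_nonneg_right (cos_le_one _)
          positivity
        linarith
      linarith
    have hr0 : 0 ≤ sin ((2 * (i + 1 : ℕ) + 1) * θ) / sin ((2 * i + 1) * θ) := by positivity
    have hr1 : sin ((2 * (i + 1 : ℕ) + 1) * θ) / sin ((2 * i + 1) * θ) ≤ 3 := by
      rwa [div_le_iff₀ hp]
    constructor
    · have : 0 ≤ x * (sin ((2 * (i + 1 : ℕ) + 1) * θ) / sin ((2 * i + 1) * θ)) := by positivity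
      linarith
    · nlinarith

/-- Since $i\ge1$, the amplitude is at most the one for $\sin 3\theta$, and this crude bound on the
oscillation is enough. -/
theorem even_term_bounds {lam θ : ℝ} (hs : sin θ = lam / 2) (h0 : 0 < lam) (h1 : lam < 7 / 20)
    (hθ : 0 < θ) {i : ℕ} (hi1 : 1 ≤ i) (hi : (2 * i + 1) * θ ≤ π / 2) (x : ℝ) :
    0 ≤ 2 / (4 - lam ^ 2) + amp lam θ i * cos x ∧ 2 / (4 - lam ^ 2) + amp lam θ i * cos x < 1 := by
  have hd : 0 < 4 - lam ^ 2 := by nlinarith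
  have hd3 : 0 < 3 - lam ^ 2 := by nlinarith
  have hA : |amp lam θ i * cos x| ≤ 2 / ((4 - lam ^ 2) * (3 - lam ^ 2)) := by
    rw [abs_mul]
    exact (mul_le_of_le_one_right (abs_nonneg _) (abs_cos_le_one x)).trans
      (abs_amp_le hs h0 h1 hθ hi1 hi)
  rw [abs_le] at hA
  have e1 : 2 / ((4 - lam ^ 2) * (3 - lam ^ 2)) ≤ 2 / (4 - lam ^ 2) := by
    rw [div_le_div_iff₀ (by positivity) hd]
    nlinarith
  have e2 : 2 / (4 - lam ^ 2) + 2 / ((4 - lam ^ 2) * (3 - lam ^ 2)) < 1 := by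
    rw [div_add_div _ _ (by positivity) (by positivity), div_lt_one (by positivity)]
    have : 0 < (4 - lam ^ 2) * ((4 - lam ^ 2) * (3 - lam ^ 2) - 2 * (3 - lam ^ 2) - 2) := by
      apply mul_pos hd
      nlinarith [sq_nonneg lam]
    nlinarith
  constructor <;> linarith [hA.1, hA.2]

theorem wavePoint_mem_admissible {lam θ : ℝ} (hs : sin θ = lam / 2) (h0 : 0 < lam)
    (h1 : lam < 7 / 20) (hθ : 0 < θ) {m : ℕ} (hm : 1 ≤ m) {i : ℕ} (hi1 : 1 ≤ i)
    (hi : (2 * i + 1) * θ ≤ π / 2) (c : ℤ)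
    (hc : ∀ k : ℕ, 1 ≤ k → k ≤ 4 * m + 1 → k % 2 = 0 →
      ∃ j : ℕ, ((k : ℤ) - (2 * m + 1) - c).natAbs = 2 * j + 1 ∧
        (j ≤ i ∨ (j = i + 1 ∧ (2 * i + 3) * θ ≤ π / 2)))
    (hstart : wavePoint lam θ (amp lam θ i) (2 * m + 1 + c) ∈ corner lam)
    (hend : wavePoint lam θ (amp lam θ i) (2 * m + 1 - c) ∈ corner lam) :
    wavePoint lam θ (amp lam θ i) (2 * m + 1 + c) ∈ admissible lam m := by
  have hd : 4 - lam ^ 2 ≠ 0 := by nlinarith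
  refine ⟨hstart, by rwa [ret_wavePoint hs hd hm], fun k hk1 hk2 => ?_⟩
  rw [orbit_wavePoint hs hd hm _ _ (by omega)]
  have hb : bump lam m (k + 1) = 0 := by
    rw [bump, if_neg (by omega), if_neg (by omega)]
  simp only [wave, hb, add_zero]
  rcases Nat.mod_two_eq_zero_or_one k with hp | hp
  · rw [center, if_neg (by omega)]
    obtain ⟨j, hj, hj'⟩ := hc k hk1 hk2 hp
    have hcos : cos ((((k + 1 : ℕ) : ℝ) - (2 * m + 2) - c) * (π / 2 - θ)) =
        cos ((2 * j + 1) * (π / 2 - θ)) := by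
      rcases Int.natAbs_eq ((k : ℤ) - (2 * m + 1) - c) with h | h
      · rw [hj] at h
        have h' : (k : ℝ) - (2 * m + 1) - c = 2 * j + 1 := by exact_mod_cast h
        congr 1
        push_cast
        linear_combination (π / 2 - θ) * h'
      · rw [hj] at h
        have h' : (k : ℝ) - (2 * m + 1) - c = -(2 * j + 1) := by exact_mod_cast h
        rw [← cos_neg]
        congr 1
        push_cast
        linear_combination -(π / 2 - θ) * h'
    rw [hcos]
    have := odd_term_bounds hs h0 h1 hθ hi hj'
    exact ⟨this.1, by linarith [this.2], fun _ => this.2⟩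
  · rw [center, if_pos (by omega)]
    have := even_term_bounds hs h0 h1 hθ hi1 hi ((((k + 1 : ℕ) : ℝ) - (2 * m + 2) - c) * (π / 2 - θ))
    exact ⟨this.1, this.2, fun h => by omega⟩

/-! ### The vertices as end-points of sinusoidal orbits -/

theorem sin_theta {lam : ℝ} (h0 : 0 < lam) (h1 : lam < 7 / 20) : sin (theta lam) = lam / 2 :=
  sin_arcsin (by linarith) (by linarith)

theorem theta_pos {lam : ℝ} (h0 : 0 < lam) : 0 < theta lam :=
  arcsin_pos.2 (by linarith)

theorem cos_theta_pos {lam : ℝ} (h0 : 0 < lam) (h1 : lam < 7 / 20) : 0 < cos (theta lam) := by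
  apply cos_pos_of_mem_Ioo
  exact ⟨by linarith [theta_pos h0, pi_pos], arcsin_lt_pi_div_two.2 (by linarith)⟩

theorem amp_mul_cos_even {lam θ : ℝ} (i j : ℕ) :
    amp lam θ i * cos ((2 * j) * (π / 2 - θ)) =
      -((-1) ^ (i + j) * (lam / (4 - lam ^ 2) *
        (cos ((2 * j) * θ) / sin ((2 * i + 1) * θ)))) := by
  rw [cos_even_mul, amp, pow_add]
  ring

theorem wavePoint_zero {lam θ : ℝ} (hs : sin θ = lam / 2) (hc : 0 < cos θ) {i : ℕ}
    (hS : 0 < sin ((2 * i + 1) * θ)) :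
    wavePoint lam θ (amp lam θ i) (2 * i + 1) =
      ((1 + 2 * lam + tan θ / tan ((2 * i + 1) * θ)) / 2, 1) := by
  have hl : lam = 2 * sin θ := by linarith
  have hsc := sin_sq_add_cos_sq θ
  have hd : 4 - lam ^ 2 = 4 * cos θ ^ 2 := by rw [hl]; linarith
  have hodd : ((-1 : ℝ)) ^ (i + (i + 1)) = -1 := Odd.neg_one_pow ⟨i, by ring⟩
  have heven : ((-1 : ℝ)) ^ (i + i) = 1 := Even.neg_one_pow ⟨i, rfl⟩
  have e1 := amp_mul_cos_even (lam := lam) (θ := θ) i (i + 1)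
  have e2 := amp_mul_cos (lam := lam) (θ := θ) i i
  rw [hodd, show (2 * ((i + 1 : ℕ) : ℝ)) * θ = (2 * i + 1) * θ + θ by push_cast; ring, cos_add,
    hd] at e1
  rw [heven, hd, div_self hS.ne'] at e2
  ext
  · simp only [wavePoint]
    rw [show (2 * (i : ℝ) + 1 + 1) = 2 * ((i + 1 : ℕ) : ℝ) by push_cast; ring, e1, hd,
      tan_eq_sin_div_cos, tan_eq_sin_div_cos, div_div_div_eq, hl]
    field_simp
    linear_combination (-4 * sin ((2 * i + 1) * θ)) * hsc
  · simp only [wavePoint]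
    rw [e2, hd]
    ring

theorem wavePoint_shift {lam θ : ℝ} (hs : sin θ = lam / 2) (hc : 0 < cos θ) {i : ℕ}
    (hS : 0 < sin ((2 * i + 1) * θ)) :
    wavePoint lam θ (amp lam θ i) (2 * i + 5) =
      ((1 + 2 * lam - lam ^ 2 + lam ^ 4 + (1 - 3 * lam ^ 2 + lam ^ 4) *
        (tan θ / tan ((2 * i + 1) * θ))) / 2,
      1 + lam ^ 3 / 2 + lam / 2 * (lam ^ 2 - 2) * (tan θ / tan ((2 * i + 1) * θ))) := by
  have hl : lam = 2 * sin θ := by linarith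
  have hsc := sin_sq_add_cos_sq θ
  have hd : 4 - lam ^ 2 = 4 * cos θ ^ 2 := by rw [hl]; linarith
  have hodd : ((-1 : ℝ)) ^ (i + (i + 3)) = -1 := Odd.neg_one_pow ⟨i + 1, by ring⟩
  have heven : ((-1 : ℝ)) ^ (i + (i + 2)) = 1 := Even.neg_one_pow ⟨i + 1, by ring⟩
  have e1 := amp_mul_cos_even (lam := lam) (θ := θ) i (i + 3)
  have e2 := amp_mul_cos (lam := lam) (θ := θ) i (i + 2)
  have s2 : sin (2 * θ) = 2 * sin θ * cos θ := sin_two_mul θ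
  have c2 : cos (2 * θ) = 1 - 2 * sin θ ^ 2 := by rw [cos_two_mul]; linear_combination 2 * hsc
  have s3 := sin_three θ
  have c3 : cos (3 * θ) = cos θ * (1 - 4 * sin θ ^ 2) := by
    rw [cos_three_mul]; linear_combination 4 * cos θ * hsc
  have s4 : sin (4 * θ) = 4 * sin θ * cos θ * (1 - 2 * sin θ ^ 2) := by
    rw [show 4 * θ = 2 * (2 * θ) by ring, sin_two_mul, s2, c2]; ring
  have c4 : cos (4 * θ) = 1 - 8 * sin θ ^ 2 * cos θ ^ 2 := by
    rw [show 4 * θ = 2 * (2 * θ) by ring, cos_two_mul, c2]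
    linear_combination 8 * sin θ ^ 2 * hsc
  have s5 : sin (5 * θ) = 2 * sin θ * cos θ ^ 2 * (1 - 4 * sin θ ^ 2) +
      (1 - 2 * sin θ ^ 2) * (sin θ * (3 - 4 * sin θ ^ 2)) := by
    rw [show 5 * θ = 2 * θ + 3 * θ by ring, sin_add, s2, c2, s3, c3]; ring
  have c5 : cos (5 * θ) = cos θ * (1 - 12 * sin θ ^ 2 + 16 * sin θ ^ 4) := by
    rw [show 5 * θ = 2 * θ + 3 * θ by ring, cos_add, s2, c2, s3, c3]; ring
  rw [hodd, show (2 * ((i + 3 : ℕ) : ℝ)) * θ = (2 * i + 1) * θ + 5 * θ by push_cast; ring, cos_add,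
    hd, s5, c5] at e1
  rw [heven, show (2 * ((i + 2 : ℕ) : ℝ) + 1) * θ = (2 * i + 1) * θ + 4 * θ by push_cast; ring,
    sin_add, hd, s4, c4] at e2
  ext
  · simp only [wavePoint]
    rw [show (2 * (i : ℝ) + 5 + 1) = 2 * ((i + 3 : ℕ) : ℝ) by push_cast; ring, e1, hd,
      tan_eq_sin_div_cos, tan_eq_sin_div_cos, div_div_div_eq, hl]
    have hc2 : cos θ ^ 2 = 1 - sin θ ^ 2 := by linarith
    field_simp
    simp only [hc2]
    linear_combination (-sin ((2 * i + 1) * θ) *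
      (16 * sin θ - 16 * sin θ ^ 2 + 64 * sin θ ^ 4 + 4)) * hc2
  · simp only [wavePoint]
    rw [show (2 * (i : ℝ) + 5) = 2 * ((i + 2 : ℕ) : ℝ) + 1 by push_cast; ring, e2, hd,
      tan_eq_sin_div_cos, tan_eq_sin_div_cos, div_div_div_eq, hl]
    field_simp
    ring

theorem P0_eq_wavePoint {lam : ℝ} (h0 : 0 < lam) (h1 : lam < 7 / 20) {m : ℕ}
    (hm : (2 * m + 1) * theta lam ≤ π / 2) :
    P0 lam m = wavePoint lam (theta lam) (amp lam (theta lam) m) (2 * m + 1) := by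
  rw [wavePoint_zero (sin_theta h0 h1) (cos_theta_pos h0 h1) (sin_odd_pos (theta_pos h0) hm), P0]

theorem P1_eq_wavePoint {lam : ℝ} (h0 : 0 < lam) (h1 : lam < 7 / 20) {i : ℕ} (hi1 : 1 ≤ i)
    (hi : (2 * i + 1) * theta lam ≤ π / 2) :
    P1 lam (i + 1) = wavePoint lam (theta lam) (amp lam (theta lam) i) (2 * i + 5) := by
  rw [wavePoint_shift (sin_theta h0 h1) (cos_theta_pos h0 h1) (sin_odd_pos (theta_pos h0) hi)]
  obtain ⟨n, rfl⟩ : ∃ n, i = n + 1 := ⟨i - 1, by omega⟩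
  have e : 2 * ((n + 2 : ℕ) : ℝ) - 1 = 2 * ((n + 1 : ℕ) : ℝ) + 1 := by push_cast; ring
  rw [P1, e]

/-! ### The quotient of tangents -/

/-- No hypotheses are needed: where $\cos x=0$ both sides are $0$ by the convention for division by
zero, which is the value required when $(2m+1)\theta=\pi/2$. -/
theorem tan_quotient_eq (θ x : ℝ) : tan θ / tan x = sin θ * cos x / (cos θ * sin x) := by
  rw [tan_eq_sin_div_cos, tan_eq_sin_div_cos, div_div_div_eq]

theorem cos_nonneg_of_le {x : ℝ} (h0 : 0 ≤ x) (h : x ≤ π / 2) : 0 ≤ cos x :=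
  cos_nonneg_of_neg_pi_div_two_le_of_le (by linarith [pi_pos]) h

theorem tan_quotient_bounds {lam : ℝ} (h0 : 0 < lam) (h1 : lam < 7 / 20) {i : ℕ} (hi1 : 1 ≤ i)
    (hi : (2 * i + 1) * theta lam ≤ π / 2) :
    0 ≤ tan (theta lam) / tan ((2 * i + 1) * theta lam) ∧
      tan (theta lam) / tan ((2 * i + 1) * theta lam) ≤ (1 - lam ^ 2) / (3 - lam ^ 2) := by
  have hθ := theta_pos h0
  have hs := sin_theta h0 h1
  have hc := cos_theta_pos h0 h1
  have hS := sin_odd_pos hθ hi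
  have hC := cos_nonneg_of_le (by positivity) hi
  have hi1' : (1 : ℝ) ≤ i := by exact_mod_cast hi1
  have hsc := sin_sq_add_cos_sq (theta lam)
  rw [tan_quotient_eq]
  constructor
  · have : 0 ≤ sin (theta lam) := by linarith
    positivity
  · rw [div_le_div_iff₀ (by positivity) (by nlinarith)]
    have hsub : 0 ≤ sin ((2 * i + 1) * theta lam - 3 * theta lam) := by
      apply sin_nonneg_of_nonneg_of_le_pi
      · nlinarith
      · nlinarith [pi_pos]
    have c3 : cos (3 * theta lam) = cos (theta lam) * (1 - 4 * sin (theta lam) ^ 2) := by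
      rw [cos_three_mul]; linear_combination 4 * cos (theta lam) * hsc
    rw [sin_sub, sin_three, c3] at hsub
    have hl : lam = 2 * sin (theta lam) := by linarith
    have e : lam ^ 2 = 4 * sin (theta lam) ^ 2 := by
      conv_lhs => rw [hl]
      ring
    rw [e]
    linarith

theorem tan_quotient_three {lam : ℝ} (h0 : 0 < lam) (h1 : lam < 7 / 20)  :
    tan (theta lam) / tan (3 * theta lam) = (1 - lam ^ 2) / (3 - lam ^ 2) := by
  have hs := sin_theta h0 h1
  have hc := cos_theta_pos h0 h1
  have hsc := sin_sq_add_cos_sq (theta lam)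
  have c3 : cos (3 * theta lam) = cos (theta lam) * (1 - 4 * sin (theta lam) ^ 2) := by
    rw [cos_three_mul]; linear_combination 4 * cos (theta lam) * hsc
  have hd : 3 - lam ^ 2 ≠ 0 := by nlinarith
  have hd' : 3 - 4 * (lam / 2) ^ 2 ≠ 0 := by nlinarith
  rw [tan_quotient_eq, sin_three, c3, hs, div_eq_div_iff (by positivity) hd]
  ring

theorem tan_quotient_lt {lam : ℝ} (h0 : 0 < lam) (h1 : lam < 7 / 20) {j : ℕ}
    (hj : (2 * (j + 1 : ℕ) + 1) * theta lam ≤ π / 2) :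
    tan (theta lam) / tan ((2 * (j + 1 : ℕ) + 1) * theta lam) <
      tan (theta lam) / tan ((2 * j + 1) * theta lam) := by
  have hθ := theta_pos h0
  have hs := sin_theta h0 h1
  have hc := cos_theta_pos h0 h1
  have hj' : (2 * (j : ℝ) + 1) * theta lam ≤ π / 2 := by push_cast at hj; nlinarith
  have hS := sin_odd_pos hθ hj
  have hS' := sin_odd_pos hθ hj'
  have hsθ : 0 < sin (theta lam) := by linarith
  rw [tan_quotient_eq, tan_quotient_eq, div_lt_div_iff₀ (by positivity) (by positivity)]
  have hsub : 0 < sin ((2 * (j + 1 : ℕ) + 1) * theta lam - (2 * j + 1) * theta lam) := by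
    rw [show (2 * ((j + 1 : ℕ) : ℝ) + 1) * theta lam - (2 * j + 1) * theta lam = 2 * theta lam by
      push_cast; ring, sin_two_mul]
    positivity
  rw [sin_sub] at hsub
  have : 0 < sin (theta lam) * cos (theta lam) := by positivity
  nlinarith

/-! ### The vertices lie in the triangle -/

/-- The formula for $P_1(m)$, $m\ge2$, is affine in the tangent quotient $t$ and traces the line of
the hypotenuse. -/
theorem ell_shift {lam : ℝ} (h0 : 0 < lam) (h1 : lam < 7 / 20) (t : ℝ) :
    ell lam ((1 + 2 * lam - lam ^ 2 + lam ^ 4 + (1 - 3 * lam ^ 2 + lam ^ 4) * t) / 2,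
      1 + lam ^ 3 / 2 + lam / 2 * (lam ^ 2 - 2) * t) = 0 := by
  have hd1 : 1 + lam - lam ^ 2 ≠ 0 := by nlinarith
  have hd2 : 2 - lam ^ 2 ≠ 0 := by nlinarith
  simp only [ell, g, gpp]
  field_simp
  ring

theorem P0_fst_lt {lam : ℝ} (h0 : 0 < lam) (h1 : lam < 7 / 20)
    (hq : 0 < 1 - 3 * lam + lam ^ 3) {m : ℕ} (hm1 : 1 ≤ m)
    (hm : (2 * m + 1) * theta lam ≤ π / 2) : (P0 lam m).1 < 1 := by
  obtain ⟨t0, t1⟩ := tan_quotient_bounds h0 h1 hm1 hm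
  simp only [P0]
  -- Clearing denominators turns this into $2(1-3\lambda+\lambda^3)>0$.
  have : (1 - lam ^ 2) / (3 - lam ^ 2) < 1 - 2 * lam := by
    rw [div_lt_iff₀ (by nlinarith)]
    nlinarith
  linarith

theorem P0_mem_corner {lam : ℝ} (h0 : 0 < lam) (h1 : lam < 7 / 20)
    (hq : 0 < 1 - 3 * lam + lam ^ 3) {m : ℕ} (hm1 : 1 ≤ m)
    (hm : (2 * m + 1) * theta lam ≤ π / 2) : P0 lam m ∈ corner lam := by
  obtain ⟨t0, t1⟩ := tan_quotient_bounds h0 h1 hm1 hm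
  refine ⟨(P0_fst_lt h0 h1 hq hm1 hm).le, le_rfl, ?_⟩
  have hg : g lam ≤ (1 + 2 * lam) / 2 := by
    rw [g, div_le_div_iff₀ (by nlinarith) (by norm_num)]
    nlinarith
  have := (gpp_bounds h0 h1).2
  simp only [ell, P0, sub_self, mul_zero, add_zero]
  apply mul_nonneg <;> linarith

theorem sin_le_sin_shift {θ : ℝ} (hθ : 0 < θ) {i : ℕ} (hi : (2 * i + 3) * θ ≤ π / 2) :
    sin ((2 * i + 1) * θ) ≤ sin ((2 * i + 5) * θ) := by
  have e : sin ((2 * i + 5) * θ) - sin ((2 * i + 1) * θ) =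
      2 * sin (2 * θ) * cos ((2 * i + 3) * θ) := by
    rw [show (2 * (i : ℝ) + 5) * θ = (2 * i + 3) * θ + 2 * θ by ring,
      show (2 * (i : ℝ) + 1) * θ = (2 * i + 3) * θ - 2 * θ by ring, sin_add, sin_sub]
    ring
  have hC := cos_nonneg_of_le (by positivity) hi
  have hs : 0 ≤ sin (2 * θ) := by
    apply sin_nonneg_of_nonneg_of_le_pi
    · linarith
    · nlinarith [(Nat.cast_nonneg i : (0 : ℝ) ≤ i)]
  have : 0 ≤ 2 * sin (2 * θ) * cos ((2 * i + 3) * θ) := by positivity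
  linarith

theorem P1_snd_eq {lam : ℝ} (h0 : 0 < lam) (h1 : lam < 7 / 20) {i : ℕ} (hi1 : 1 ≤ i)
    (hi : (2 * i + 1) * theta lam ≤ π / 2) :
    (P1 lam (i + 1)).2 = 1 - lam / (4 - lam ^ 2) *
      (sin ((2 * i + 5) * theta lam) / sin ((2 * i + 1) * theta lam) - 1) := by
  rw [P1_eq_wavePoint h0 h1 hi1 hi]
  have heven : ((-1 : ℝ)) ^ (i + (i + 2)) = 1 := Even.neg_one_pow ⟨i + 1, by ring⟩
  have e := amp_mul_cos (lam := lam) (θ := theta lam) i (i + 2)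
  rw [heven, show 2 * ((i + 2 : ℕ) : ℝ) + 1 = 2 * i + 5 by push_cast; ring] at e
  simp only [wavePoint, e]
  ring

/-- The ordinate is at most 1 because $\sin(2i+1)\theta\le\sin(2i+5)\theta$, which only needs the
mean angle $(2i+3)\theta$ to be at most $\pi/2$. -/
theorem P1_mem_corner {lam : ℝ} (h0 : 0 < lam) (h1 : lam < 7 / 20) {i : ℕ} (hi1 : 1 ≤ i)
    (hi : (2 * i + 3) * theta lam ≤ π / 2) :
    P1 lam (i + 1) ∈ corner lam ∧ ell lam (P1 lam (i + 1)) = 0 := by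
  have hθ := theta_pos h0
  have hi' : (2 * i + 1) * theta lam ≤ π / 2 := by linarith
  have hS := sin_odd_pos hθ hi'
  obtain ⟨t0, t1⟩ := tan_quotient_bounds h0 h1 hi1 hi'
  have hell : ell lam (P1 lam (i + 1)) = 0 := by
    rw [P1_eq_wavePoint h0 h1 hi1 hi', wavePoint_shift (sin_theta h0 h1) (cos_theta_pos h0 h1) hS,
      ell_shift h0 h1]
  refine ⟨⟨?_, ?_, hell.ge⟩, hell⟩
  · rw [P1_eq_wavePoint h0 h1 hi1 hi', wavePoint_shift (sin_theta h0 h1) (cos_theta_pos h0 h1) hS]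
    simp only
    set t := tan (theta lam) / tan ((2 * i + 1) * theta lam)
    have ht : t ≤ 1 / 3 := by
      refine t1.trans ?_
      rw [div_le_div_iff₀ (by nlinarith) (by norm_num)]
      nlinarith
    have hl2 : lam ^ 2 ≤ 1 / 8 := by nlinarith
    have hl4 : lam ^ 4 ≤ lam ^ 2 / 8 := by nlinarith [sq_nonneg lam]
    have hk : (1 - 3 * lam ^ 2 + lam ^ 4) * t ≤ 1 * t := by
      apply mul_le_mul_of_nonneg_right _ t0
      nlinarith [sq_nonneg lam]
    nlinarith
  · rw [P1_snd_eq h0 h1 hi1 hi']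
    have h := sin_le_sin_shift hθ hi
    have h2 : 1 ≤ sin ((2 * i + 5) * theta lam) / sin ((2 * i + 1) * theta lam) := by
      rwa [le_div_iff₀ hS, one_mul]
    have h3 : 0 < lam / (4 - lam ^ 2) := div_pos h0 (by nlinarith)
    nlinarith

theorem P1_snd_lt {lam : ℝ} (h0 : 0 < lam) (h1 : lam < 7 / 20) {i : ℕ} (hi1 : 1 ≤ i)
    (hi : (2 * i + 5) * theta lam ≤ π / 2) : (P1 lam (i + 1)).2 < 1 := by
  have hθ := theta_pos h0
  have hi' : (2 * i + 1) * theta lam ≤ π / 2 := by linarith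
  have hS := sin_odd_pos hθ hi'
  rw [P1_snd_eq h0 h1 hi1 hi']
  have h2 : 1 < sin ((2 * i + 5) * theta lam) / sin ((2 * i + 1) * theta lam) := by
    rw [lt_div_iff₀ hS, one_mul]
    apply sin_lt_sin_of_lt_of_le_pi_div_two _ hi
    · linarith
    · have : 0 ≤ (2 * (i : ℝ) + 1) * theta lam := by positivity
      linarith [pi_pos]
  have h3 : 0 < lam / (4 - lam ^ 2) := div_pos h0 (by nlinarith)
  nlinarith

/-! ### The orbits of the regular vertices -/

theorem ret_P0 {lam : ℝ} (h0 : 0 < lam) (h1 : lam < 7 / 20) {m : ℕ} (hm1 : 1 ≤ m)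
    (hm : (2 * m + 1) * theta lam ≤ π / 2) : ret lam m (P0 lam m) = P0 lam m := by
  rw [P0_eq_wavePoint h0 h1 hm]
  have := ret_wavePoint (sin_theta h0 h1) (by nlinarith) hm1 (amp lam (theta lam) m) 0
  rwa [add_zero, sub_zero] at this

theorem P0_mem_admissible {lam : ℝ} (h0 : 0 < lam) (h1 : lam < 7 / 20)
    (hq : 0 < 1 - 3 * lam + lam ^ 3) {m : ℕ} (hm1 : 1 ≤ m)
    (hm : (2 * m + 1) * theta lam ≤ π / 2) : P0 lam m ∈ admissible lam m := by
  have hcorner := P0_mem_corner h0 h1 hq hm1 hm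
  rw [P0_eq_wavePoint h0 h1 hm] at hcorner ⊢
  have := wavePoint_mem_admissible (sin_theta h0 h1) h0 h1 (theta_pos h0) hm1 hm1 hm 0
    (fun k hk1 hk2 hk3 => ⟨(((k : ℤ) - (2 * m + 1) - 0).natAbs - 1) / 2, by omega,
      Or.inl (by omega)⟩)
  rw [Int.cast_zero, add_zero, sub_zero] at this
  exact this hcorner hcorner

/-- For the code of index $j+1$ the sinusoid of $P_0(j)$ has offset $-2$, so its other end has
offset $2$. -/
theorem ret_P0_pred {lam : ℝ} (h0 : 0 < lam) (h1 : lam < 7 / 20) {j : ℕ} (hj1 : 1 ≤ j)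
    (hj : (2 * j + 1) * theta lam ≤ π / 2) : ret lam (j + 1) (P0 lam j) = P1 lam (j + 1) := by
  rw [P0_eq_wavePoint h0 h1 hj, P1_eq_wavePoint h0 h1 hj1 hj]
  have := ret_wavePoint (sin_theta h0 h1) (by nlinarith) (Nat.le_add_left 1 j)
    (amp lam (theta lam) j) (-2)
  push_cast at this
  convert this using 2 <;> ring_nf

theorem P0_pred_mem_admissible {lam : ℝ} (h0 : 0 < lam) (h1 : lam < 7 / 20)
    (hq : 0 < 1 - 3 * lam + lam ^ 3) {j : ℕ} (hj1 : 1 ≤ j)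
    (hj : (2 * j + 3) * theta lam ≤ π / 2) : P0 lam j ∈ admissible lam (j + 1) := by
  have hθ := theta_pos h0
  have hj' : (2 * j + 1) * theta lam ≤ π / 2 := by linarith
  have hc1 := P0_mem_corner h0 h1 hq hj1 hj'
  have hc2 := (P1_mem_corner h0 h1 hj1 hj).1
  rw [P1_eq_wavePoint h0 h1 hj1 hj'] at hc2
  rw [P0_eq_wavePoint h0 h1 hj'] at hc1 ⊢
  have := wavePoint_mem_admissible (sin_theta h0 h1) h0 h1 hθ (Nat.le_add_left 1 j) hj1 hj' (-2)
    (fun k hk1 hk2 hk3 => ⟨(((k : ℤ) - (2 * (j + 1 : ℕ) + 1) - (-2)).natAbs - 1) / 2, by omega, by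
      by_cases h : (((k : ℤ) - (2 * (j + 1 : ℕ) + 1) - (-2)).natAbs - 1) / 2 ≤ j
      · exact Or.inl h
      · exact Or.inr ⟨by omega, hj⟩⟩)
  rw [show 2 * ((j + 1 : ℕ) : ℝ) + 1 + ((-2 : ℤ) : ℝ) = 2 * j + 1 by push_cast; ring,
    show 2 * ((j + 1 : ℕ) : ℝ) + 1 - ((-2 : ℤ) : ℝ) = 2 * j + 5 by push_cast; ring] at this
  exact this hc1 hc2

theorem ret_P1_pred {lam : ℝ} (h0 : 0 < lam) (h1 : lam < 7 / 20) {i : ℕ} (hi1 : 1 ≤ i)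
    (hi : (2 * i + 1) * theta lam ≤ π / 2) :
    ret lam (i + 2) (P1 lam (i + 1)) = P1 lam (i + 1) := by
  rw [P1_eq_wavePoint h0 h1 hi1 hi]
  have := ret_wavePoint (sin_theta h0 h1) (by nlinarith) (by omega : 1 ≤ i + 2)
    (amp lam (theta lam) i) 0
  push_cast at this
  convert this using 2 <;> ring_nf

theorem P1_pred_mem_admissible {lam : ℝ} (h0 : 0 < lam) (h1 : lam < 7 / 20) {i : ℕ} (hi1 : 1 ≤ i)
    (hi : (2 * i + 3) * theta lam ≤ π / 2) : P1 lam (i + 1) ∈ admissible lam (i + 2) := by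
  have hθ := theta_pos h0
  have hi' : (2 * i + 1) * theta lam ≤ π / 2 := by linarith
  have hc2 := (P1_mem_corner h0 h1 hi1 hi).1
  rw [P1_eq_wavePoint h0 h1 hi1 hi'] at hc2 ⊢
  have := wavePoint_mem_admissible (sin_theta h0 h1) h0 h1 hθ (by omega : 1 ≤ i + 2) hi1 hi' 0
    -- The extreme odd positions are at distance $2m-1=2i+3$ from the middle, one place beyond the
    -- zero of the sinusoid; this uses the second alternative.
    (fun k hk1 hk2 hk3 => ⟨(((k : ℤ) - (2 * (i + 2 : ℕ) + 1) - 0).natAbs - 1) / 2, by omega, by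
      by_cases h : (((k : ℤ) - (2 * (i + 2 : ℕ) + 1) - 0).natAbs - 1) / 2 ≤ i
      · exact Or.inl h
      · exact Or.inr ⟨by omega, hi⟩⟩)
  rw [show 2 * ((i + 2 : ℕ) : ℝ) + 1 + ((0 : ℤ) : ℝ) = 2 * i + 5 by push_cast; ring,
    show 2 * ((i + 2 : ℕ) : ℝ) + 1 - ((0 : ℤ) : ℝ) = 2 * i + 5 by push_cast; ring] at this
  exact this hc2 hc2

theorem wavePoint_mem_segment (lam θ k κ : ℝ) {u v w : ℝ} (huv : u ≤ v) (hvw : v ≤ w) :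
    wavePoint lam θ (κ * v) k ∈
      segment ℝ (wavePoint lam θ (κ * u) k) (wavePoint lam θ (κ * w) k) := by
  have hv : v ∈ segment ℝ u w := by
    rw [segment_eq_Icc (huv.trans hvw)]
    exact ⟨huv, hvw⟩
  obtain ⟨a, b, ha, hb, hab, rfl⟩ := hv
  refine ⟨a, b, ha, hb, hab, ?_⟩
  obtain rfl : b = 1 - a := by linarith
  ext <;> simp [wavePoint] <;> ring

/-- Averaging the ends at distances $k\pm2$ multiplies the amplitude by the cosine of twice the
step. So the midpoint and both end-points of the segment are `wavePoint`s with the same $k=2i+5$,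
and only their amplitudes must be compared: $1/\sin(2i+5)\theta\le\cos
2\theta/\sin(2i+3)\theta\le1/\sin(2i+1)\theta$. -/
theorem midpoint_P0_P1_mem_segment {lam : ℝ} (h0 : 0 < lam) (h1 : lam < 7 / 20) {i : ℕ}
    (hi1 : 1 ≤ i) (hi : (2 * i + 5) * theta lam ≤ π / 2) :
    midpoint ℝ (P0 lam (i + 1)) (P1 lam (i + 2)) ∈
      segment ℝ (P0 lam (i + 2)) (P1 lam (i + 1)) := by
  have hθ := theta_pos h0
  have hi' : (2 * i + 1) * theta lam ≤ π / 2 := by linarith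
  have hi3 : (2 * ((i + 1 : ℕ) : ℝ) + 1) * theta lam ≤ π / 2 := by push_cast; linarith
  have hi5 : (2 * ((i + 2 : ℕ) : ℝ) + 1) * theta lam ≤ π / 2 := by push_cast; linarith
  have hS1 := sin_odd_pos hθ hi'
  have hS3 := sin_odd_pos hθ hi3
  have hS5 := sin_odd_pos hθ hi5
  have hw := wavePoint_mem_segment lam (theta lam) (2 * i + 5)
    (-((-1) ^ i * (lam / (4 - lam ^ 2)))) (u := 1 / sin ((2 * ((i + 2 : ℕ) : ℝ) + 1) * theta lam))
    (v := cos (2 * theta lam) / sin ((2 * ((i + 1 : ℕ) : ℝ) + 1) * theta lam))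
    (w := 1 / sin ((2 * i + 1) * theta lam)) (by
      rw [div_le_div_iff₀ hS5 hS3, one_mul]
      have h := sin_le_sin_shift hθ (i := i + 1) (by push_cast; linarith)
      rw [show (2 * ((i + 1 : ℕ) : ℝ) + 5) * theta lam =
          (2 * ((i + 2 : ℕ) : ℝ) + 1) * theta lam + 2 * theta lam by push_cast; ring, sin_add] at h
      have h2 : sin ((2 * ((i + 1 : ℕ) : ℝ) + 1) * theta lam) =
          sin ((2 * ((i + 2 : ℕ) : ℝ) + 1) * theta lam - 2 * theta lam) := by
        congr 1
        push_cast
        ring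
      rw [sin_sub] at h2
      linarith) (by
      rw [div_le_div_iff₀ hS3 hS1, one_mul]
      refine (mul_le_of_le_one_left hS1.le (cos_le_one _)).trans ?_
      apply sin_le_sin_of_le_of_le_pi_div_two _ hi3
      · push_cast
        linarith
      · have : 0 ≤ (2 * (i : ℝ) + 1) * theta lam := by positivity
        linarith [pi_pos])
  have hcos : cos (2 * (π / 2 - theta lam)) = -cos (2 * theta lam) := by
    rw [show 2 * (π / 2 - theta lam) = π - 2 * theta lam by ring, cos_pi_sub]
  convert hw using 1
  · rw [P0_eq_wavePoint h0 h1 hi5, P1_eq_wavePoint h0 h1 hi1 hi']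
    congr 2
    · rw [amp, pow_add]
      ring
    · push_cast; ring
    · rw [amp]
      ring
  · rw [P0_eq_wavePoint h0 h1 hi3, P1_eq_wavePoint h0 h1 (by omega) hi3, midpoint_eq_smul_add]
    have a1 : cos ((2 * ((i + 1 : ℕ) : ℝ) + 1 + 1) * (π / 2 - theta lam)) =
        cos ((2 * i + 5 + 1) * (π / 2 - theta lam) - 2 * (π / 2 - theta lam)) := by
      congr 1; push_cast; ring
    have a2 : cos ((2 * ((i + 1 : ℕ) : ℝ) + 5 + 1) * (π / 2 - theta lam)) =
        cos ((2 * i + 5 + 1) * (π / 2 - theta lam) + 2 * (π / 2 - theta lam)) := by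
      congr 1; push_cast; ring
    have a3 : cos ((2 * ((i + 1 : ℕ) : ℝ) + 1) * (π / 2 - theta lam)) =
        cos ((2 * i + 5) * (π / 2 - theta lam) - 2 * (π / 2 - theta lam)) := by
      congr 1; push_cast; ring
    have a4 : cos ((2 * ((i + 1 : ℕ) : ℝ) + 5) * (π / 2 - theta lam)) =
        cos ((2 * i + 5) * (π / 2 - theta lam) + 2 * (π / 2 - theta lam)) := by
      congr 1; push_cast; ring
    have hamp : amp lam (theta lam) (i + 1) = (-1) ^ i * (lam / (4 - lam ^ 2)) /
        sin ((2 * ((i + 1 : ℕ) : ℝ) + 1) * theta lam) := by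
      rw [amp, pow_succ]
      ring
    ext
    · simp only [wavePoint, Prod.smul_fst, Prod.fst_add, smul_eq_mul]
      rw [a1, a2, cos_sub, cos_add, hcos, hamp, invOf_eq_inv]
      ring
    · simp only [wavePoint, Prod.smul_snd, Prod.snd_add, smul_eq_mul]
      rw [a3, a4, cos_sub, cos_add, hcos, hamp, invOf_eq_inv]
      ring

/-! ### The quadrilaterals -/

theorem quadrilateral_atom {lam : ℝ} (h0 : 0 < lam) (h1 : lam < 7 / 20)
    (hq : 0 < 1 - 3 * lam + lam ^ 3) {i : ℕ} (hi1 : 1 ≤ i)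
    (hi : (2 * i + 5) * theta lam ≤ π / 2) :
    outVertices lam (i + 2) ⊆ admissible lam (i + 2) ∧
      (∀ v ∈ outVertices lam (i + 2), ret lam (i + 2) v ∈ outVertices lam (i + 2)) ∧
      (∀ v ∈ outVertices lam (i + 2),
        midpoint ℝ v (ret lam (i + 2) v) ∈ segment ℝ (P0 lam (i + 2)) (P1 lam (i + 1))) ∧
      ret lam (i + 2) (P0 lam (i + 2)) = P0 lam (i + 2) ∧
      ret lam (i + 2) (P1 lam (i + 1)) = P1 lam (i + 1) ∧
      ell lam (P1 lam (i + 1)) = 0 ∧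
      (interior (convexHull ℝ (outVertices lam (i + 2)))).Nonempty := by
  have hV : outVertices lam (i + 2) =
      {P0 lam (i + 2), P0 lam (i + 1), P1 lam (i + 1), P1 lam (i + 2)} := by
    obtain ⟨j, rfl⟩ : ∃ j, i = j + 1 := ⟨i - 1, by omega⟩
    rfl
  rw [hV]
  have hθ := theta_pos h0
  have hi' : (2 * i + 1) * theta lam ≤ π / 2 := by linarith
  have hi3' : (2 * i + 3) * theta lam ≤ π / 2 := by linarith
  have hi3 : (2 * ((i + 1 : ℕ) : ℝ) + 1) * theta lam ≤ π / 2 := by push_cast; linarith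
  have hi5' : (2 * ((i + 1 : ℕ) : ℝ) + 3) * theta lam ≤ π / 2 := by push_cast; linarith
  have hi5 : (2 * ((i + 2 : ℕ) : ℝ) + 1) * theta lam ≤ π / 2 := by push_cast; linarith
  have f1 := ret_P0 h0 h1 (by omega : 1 ≤ i + 2) hi5
  have f2 : ret lam (i + 2) (P0 lam (i + 1)) = P1 lam (i + 2) :=
    ret_P0_pred h0 h1 (by omega : 1 ≤ i + 1) hi3
  have f3 := ret_P1_pred h0 h1 hi1 hi'
  have f4 : ret lam (i + 2) (P1 lam (i + 2)) = P0 lam (i + 1) := by rw [← f2, ret_ret]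
  have b2 : P0 lam (i + 1) ∈ admissible lam (i + 2) :=
    P0_pred_mem_admissible h0 h1 hq (by omega : 1 ≤ i + 1) hi5'
  have hmid := midpoint_P0_P1_mem_segment h0 h1 hi1 hi
  refine ⟨?_, ?_, ?_, f1, f3, (P1_mem_corner h0 h1 hi1 hi3').2, ?_⟩
  · rintro v (rfl | rfl | rfl | rfl)
    · exact P0_mem_admissible h0 h1 hq (by omega) hi5
    · exact b2
    · exact P1_pred_mem_admissible h0 h1 hi1 hi3'
    · rw [← f2]
      exact ret_mem_admissible b2
  · rintro v (rfl | rfl | rfl | rfl)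
    · rw [f1]; simp
    · rw [f2]; simp
    · rw [f3]; simp
    · rw [f4]; simp
  · rintro v (rfl | rfl | rfl | rfl)
    · rw [f1, midpoint_self]
      exact left_mem_segment ℝ _ _
    · rwa [f2]
    · rw [f3, midpoint_self]
      exact right_mem_segment ℝ _ _
    · rwa [f4, midpoint_comm]
  · refine interior_convexHull_nonempty_of_triangle (a := (P0 lam (i + 2)).1)
      (b := (P0 lam (i + 1)).1) (c := (P1 lam (i + 1)).1) (y := (P1 lam (i + 1)).2) ?_
      (P1_snd_lt h0 h1 hi1 hi).ne (Or.inl rfl) (Or.inr (Or.inl rfl)) (Or.inr (Or.inr (Or.inl rfl)))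
    have := tan_quotient_lt h0 h1 hi5
    simp only [P0]
    intro h
    linarith

/-! ### Orbits of the exceptional vertices -/

/-- The last hypothesis is `ell` cleared of denominators and of the factor $1-\lambda$ common to
$1-g$ and $1-g''$. -/
theorem mem_corner_of_scaled {lam : ℝ} (h0 : 0 < lam) (h1 : lam < 7 / 20) {a b d : ℝ} (hd : 0 < d)
    (ha : a ≤ d) (hb : b ≤ d)
    (h : 0 ≤ lam * ((2 - lam ^ 2) * a - (1 + 2 * lam - lam ^ 2 - lam ^ 3) * d) +
      (1 - lam - lam ^ 2) * (1 + lam - lam ^ 2) * (b - d)) : (a / d, b / d) ∈ corner lam := by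
  refine ⟨(div_le_one hd).2 ha, (div_le_one hd).2 hb, ?_⟩
  have hd1 : 0 < 1 + lam - lam ^ 2 := by nlinarith
  have hd2 : 0 < 2 - lam ^ 2 := by nlinarith
  have e : ell lam (a / d, b / d) = (1 - lam) / ((1 + lam - lam ^ 2) * (2 - lam ^ 2) * d) *
      (lam * ((2 - lam ^ 2) * a - (1 + 2 * lam - lam ^ 2 - lam ^ 3) * d) +
      (1 - lam - lam ^ 2) * (1 + lam - lam ^ 2) * (b - d)) := by
    simp only [ell, g, gpp]
    field_simp
    ring
  rw [e]
  have : 0 ≤ 1 - lam := by linarith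
  positivity

/-- Multiplying the orbit by the common denominator $d$ turns it into a sequence of polynomials in
$\lambda$, so each condition is a polynomial inequality. -/
theorem mem_admissible_of_scaled {lam : ℝ} {m : ℕ} {N : ℕ → ℝ} {d : ℝ} (hd : 0 < d)
    (hN : ∀ k < 4 * m + 3, N (k + 2) = lam * N (k + 1) - N k + symbol m k * d)
    (hstart : (N 0 / d, N 1 / d) ∈ corner lam)
    (hend : (N (4 * m + 4) / d, N (4 * m + 3) / d) ∈ corner lam)
    (hmid : ∀ k, 1 ≤ k → k ≤ 4 * m + 1 →
      0 ≤ N (k + 1) ∧ N (k + 1) < d ∧ (k % 2 = 0 → 2 * N (k + 1) ≤ d)) :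
    (N 0 / d, N 1 / d) ∈ admissible lam m ∧
      ret lam m (N 0 / d, N 1 / d) = (N (4 * m + 4) / d, N (4 * m + 3) / d) := by
  have horb := orbit_eq_of_recurrence lam m (fun k => N k / d) (4 * m + 3) (fun k hk => by
    simp only [hN k hk]
    field_simp)
  have hret : ret lam m (N 0 / d, N 1 / d) = (N (4 * m + 4) / d, N (4 * m + 3) / d) :=
    horb _ le_rfl
  refine ⟨⟨hstart, hret ▸ hend, fun k hk1 hk2 => ?_⟩, hret⟩
  rw [horb k (by omega)]
  obtain ⟨b1, b2, b3⟩ := hmid k hk1 hk2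
  refine ⟨by positivity, (div_lt_one hd).2 b2, fun h => ?_⟩
  simp only
  rw [div_le_div_iff₀ hd (by norm_num)]
  linarith [b3 h]

/-- These bounds let `linarith` treat the powers of $\lambda$ as independent variables, each below
$7/20$ of the previous one. -/
theorem pow_succ_bounds {lam : ℝ} (h0 : 0 < lam) (h1 : lam < 7 / 20) (n : ℕ) :
    0 < lam ^ n ∧ lam ^ (n + 1) < 7 / 20 * lam ^ n := by
  have := pow_pos h0 n
  exact ⟨this, by rw [pow_succ]; nlinarith⟩

theorem pow_mul_pos {lam : ℝ} (h0 : 0 < lam) (hq : 0 < 1 - 3 * lam + lam ^ 3) (n : ℕ) :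
    0 < lam ^ n * (1 - 3 * lam + lam ^ 3) := mul_pos (pow_pos h0 n) hq

theorem corner_vertex {lam : ℝ} (h0 : 0 < lam) (h1 : lam < 7 / 20)
    (hq : 0 < 1 - 3 * lam + lam ^ 3) :
    ((1, 1) : ℝ × ℝ) ∈ admissible lam 1 ∧ ret lam 1 (1, 1) = Pprime lam := by
  obtain ⟨p1, r1⟩ := pow_succ_bounds h0 h1 1
  obtain ⟨p2, r2⟩ := pow_succ_bounds h0 h1 2
  obtain ⟨p3, r3⟩ := pow_succ_bounds h0 h1 3
  obtain ⟨p4, r4⟩ := pow_succ_bounds h0 h1 4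
  obtain ⟨p5, r5⟩ := pow_succ_bounds h0 h1 5
  obtain ⟨p6, r6⟩ := pow_succ_bounds h0 h1 6
  norm_num at r1 r2 r3 r4 r5 r6
  -- This and the next quantity are exactly $1-x$ and $1-y$ at $P'=(x,y)$.
  have hx : 0 < lam ^ 2 * (2 - lam ^ 2) * (1 - 3 * lam + lam ^ 3) := by
    have : 0 < 2 - lam ^ 2 := by linarith
    positivity
  have hy : 0 < lam * (1 - lam ^ 2) * (1 - 3 * lam + lam ^ 3) := by
    have : 0 < 1 - lam ^ 2 := by linarith
    positivity
  have key := mem_admissible_of_scaled (lam := lam) (m := 1) (d := 1)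
    (N := fun k => ([1, 1, lam, lam ^ 2, 1 - lam + lam ^ 3, lam - 2 * lam ^ 2 + lam ^ 4,
      lam + lam ^ 2 - 3 * lam ^ 3 + lam ^ 5,
      1 - lam + 3 * lam ^ 2 + lam ^ 3 - 4 * lam ^ 4 + lam ^ 6,
      1 - 2 * lam ^ 2 + 6 * lam ^ 3 + lam ^ 4 - 5 * lam ^ 5 + lam ^ 7]
      : List ℝ).getD k 0)
    one_pos
    (by
      intro k hk
      interval_cases k <;> simp [symbol] <;> ring)
    (mem_corner_of_scaled h0 h1 one_pos (by simp) (by simp)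
      (by simp; nlinarith))
    (mem_corner_of_scaled h0 h1 one_pos (by simp; linarith) (by simp; linarith) (by simp; linarith))
    (by
      intro k hk1 hk2
      interval_cases k <;> simp [-sq_lt_one_iff_abs_lt_one] <;> refine ⟨?_, ?_⟩ <;>
        (try constructor) <;> linarith)
  simpa [Pprime] using key

/-- The list of numerators is a palindrome, which is why the vertex is fixed. -/
theorem P1_zero_vertex {lam : ℝ} (h0 : 0 < lam) (h1 : lam < 7 / 20)
    (hq : 0 < 1 - 3 * lam + lam ^ 3) :
    P1 lam 0 ∈ admissible lam 1 ∧ ret lam 1 (P1 lam 0) = P1 lam 0 := by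
  obtain ⟨p1, r1⟩ := pow_succ_bounds h0 h1 1
  obtain ⟨p2, r2⟩ := pow_succ_bounds h0 h1 2
  obtain ⟨p3, r3⟩ := pow_succ_bounds h0 h1 3
  have q1 := pow_mul_pos h0 hq 1
  norm_num at r1 r2 r3
  have hd : 0 < 2 - 4 * lam ^ 2 + lam ^ 4 := by linarith
  have key := mem_admissible_of_scaled (lam := lam) (m := 1) (d := 2 - 4 * lam ^ 2 + lam ^ 4)
    (N := fun k => ([2 - 4 * lam ^ 2 + lam ^ 4, 2 - lam - lam ^ 2, 2 * lam - lam ^ 2 - lam ^ 3,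
      lam - lam ^ 2 - lam ^ 3, 2 - 2 * lam - 2 * lam ^ 2, lam - lam ^ 2 - lam ^ 3,
      2 * lam - lam ^ 2 - lam ^ 3, 2 - lam - lam ^ 2, 2 - 4 * lam ^ 2 + lam ^ 4]
      : List ℝ).getD k 0)
    hd
    (by
      intro k hk
      interval_cases k <;> simp [symbol] <;> ring)
    (mem_corner_of_scaled h0 h1 hd (by simp) (by simp; linarith) (by simp; linarith))
    (mem_corner_of_scaled h0 h1 hd (by simp) (by simp; linarith) (by simp; linarith))
    (by
      intro k hk1 hk2
      interval_cases k <;> simp [-sq_lt_one_iff_abs_lt_one] <;> refine ⟨?_, ?_⟩ <;>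
        (try constructor) <;> linarith)
  simpa [P1, div_self hd.ne'] using key

theorem P1_one_vertex {lam : ℝ} (h0 : 0 < lam) (h1 : lam < 7 / 20) :
    P1 lam 1 ∈ admissible lam 2 ∧ ret lam 2 (P1 lam 1) = P1 lam 1 := by
  obtain ⟨p1, r1⟩ := pow_succ_bounds h0 h1 1
  obtain ⟨p2, r2⟩ := pow_succ_bounds h0 h1 2
  obtain ⟨p3, r3⟩ := pow_succ_bounds h0 h1 3
  obtain ⟨p4, r4⟩ := pow_succ_bounds h0 h1 4
  obtain ⟨p5, r5⟩ := pow_succ_bounds h0 h1 5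
  norm_num at r1 r2 r3 r4 r5
  have hd : 0 < 2 - 9 * lam ^ 2 + 6 * lam ^ 4 - lam ^ 6 := by linarith
  have key := mem_admissible_of_scaled (lam := lam) (m := 2)
    (d := 2 - 9 * lam ^ 2 + 6 * lam ^ 4 - lam ^ 6)
    (N := fun k => ([2 - 9 * lam ^ 2 + 6 * lam ^ 4 - lam ^ 6,
      2 - 2 * lam - 4 * lam ^ 2 + lam ^ 3 + lam ^ 4,
      2 * lam - 2 * lam ^ 2 - 4 * lam ^ 3 + lam ^ 4 + lam ^ 5,
      2 * lam - 3 * lam ^ 2 - 3 * lam ^ 3 + lam ^ 4 + lam ^ 5,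
      2 - 2 * lam - 5 * lam ^ 2 + lam ^ 3 + 2 * lam ^ 4, lam ^ 2 - 2 * lam ^ 3 + lam ^ 5,
      2 * lam - 4 * lam ^ 2 + 2 * lam ^ 4, lam ^ 2 - 2 * lam ^ 3 + lam ^ 5,
      2 - 2 * lam - 5 * lam ^ 2 + lam ^ 3 + 2 * lam ^ 4,
      2 * lam - 3 * lam ^ 2 - 3 * lam ^ 3 + lam ^ 4 + lam ^ 5,
      2 * lam - 2 * lam ^ 2 - 4 * lam ^ 3 + lam ^ 4 + lam ^ 5,
      2 - 2 * lam - 4 * lam ^ 2 + lam ^ 3 + lam ^ 4, 2 - 9 * lam ^ 2 + 6 * lam ^ 4 - lam ^ 6]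
      : List ℝ).getD k 0)
    hd
    (by
      intro k hk
      interval_cases k <;> simp [symbol] <;> ring)
    (mem_corner_of_scaled h0 h1 hd (by simp) (by simp; linarith) (by simp; linarith))
    (mem_corner_of_scaled h0 h1 hd (by simp) (by simp; linarith) (by simp; linarith))
    (by
      intro k hk1 hk2
      interval_cases k <;> simp [-sq_lt_one_iff_abs_lt_one] <;> refine ⟨?_, ?_⟩ <;>
        (try constructor) <;> linarith)
  simpa [P1, div_self hd.ne'] using key

theorem Psecond_vertex {lam : ℝ} (h0 : 0 < lam) (h1 : lam < 7 / 20)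
    (hq : 0 < 1 - 3 * lam + lam ^ 3) :
    Psecond lam ∈ admissible lam 2 ∧ ret lam 2 (Psecond lam) = Pthird lam := by
  obtain ⟨p1, r1⟩ := pow_succ_bounds h0 h1 1
  obtain ⟨p2, r2⟩ := pow_succ_bounds h0 h1 2
  obtain ⟨p3, r3⟩ := pow_succ_bounds h0 h1 3
  obtain ⟨p4, r4⟩ := pow_succ_bounds h0 h1 4
  obtain ⟨p5, r5⟩ := pow_succ_bounds h0 h1 5
  obtain ⟨p6, r6⟩ := pow_succ_bounds h0 h1 6
  obtain ⟨p7, r7⟩ := pow_succ_bounds h0 h1 7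
  obtain ⟨p8, r8⟩ := pow_succ_bounds h0 h1 8
  obtain ⟨p9, r9⟩ := pow_succ_bounds h0 h1 9
  obtain ⟨p10, r10⟩ := pow_succ_bounds h0 h1 10
  have q1 := pow_mul_pos h0 hq 1
  have q2 := pow_mul_pos h0 hq 2
  have q3 := pow_mul_pos h0 hq 3
  norm_num at r1 r2 r3 r4 r5 r6 r7 r8 r9 r10
  -- This is the denominator minus the numerator of the ordinate of $P''$.
  have hy : 0 < lam * (1 - lam ^ 2) * (1 - 3 * lam + lam ^ 3) := by
    have : 0 < 1 - lam ^ 2 := by linarith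
    positivity
  have hz : 0 ≤ lam * (1 - 2 * lam) ^ 2 := by positivity
  have hd : 0 < 1 - 6 * lam ^ 2 + 5 * lam ^ 4 - lam ^ 6 := by linarith
  have key := mem_admissible_of_scaled (lam := lam) (m := 2)
    (d := 1 - 6 * lam ^ 2 + 5 * lam ^ 4 - lam ^ 6)
    (N := fun k => ([1 - 6 * lam ^ 2 + 5 * lam ^ 4 - lam ^ 6,
      1 - lam - 3 * lam ^ 2 + lam ^ 3 + lam ^ 4, lam - lam ^ 2 - 3 * lam ^ 3 + lam ^ 4 + lam ^ 5,
      lam - 2 * lam ^ 2 - 2 * lam ^ 3 + lam ^ 4 + lam ^ 5,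
      1 - lam - 4 * lam ^ 2 + lam ^ 3 + 2 * lam ^ 4, lam ^ 2 - 2 * lam ^ 3 + lam ^ 5,
      lam - 2 * lam ^ 2 + lam ^ 4, 0, 1 - lam - 4 * lam ^ 2 + 4 * lam ^ 4 - lam ^ 6,
      lam - lam ^ 2 - 4 * lam ^ 3 + 4 * lam ^ 5 - lam ^ 7,
      lam - lam ^ 2 - lam ^ 3 - 3 * lam ^ 4 + 4 * lam ^ 6 - lam ^ 8,
      1 - lam - 4 * lam ^ 2 + 3 * lam ^ 3 + 4 * lam ^ 4 - 7 * lam ^ 5 - lam ^ 6 + 5 * lam ^ 7 - lam ^ 9,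
      1 - 6 * lam ^ 2 - 3 * lam ^ 3 + 11 * lam ^ 4 + 4 * lam ^ 5 - 12 * lam ^ 6 - lam ^ 7 + 6 * lam ^ 8 - lam ^ 10]
      : List ℝ).getD k 0)
    hd
    (by
      intro k hk
      interval_cases k <;> simp [symbol] <;> ring)
    (mem_corner_of_scaled h0 h1 hd (by simp) (by simp; linarith) (by simp; linarith))
    (mem_corner_of_scaled h0 h1 hd (by simp; linarith) (by simp; linarith) (by simp; linarith))
    (by
      intro k hk1 hk2
      interval_cases k <;> simp [-sq_lt_one_iff_abs_lt_one] <;> refine ⟨?_, ?_⟩ <;>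
        (try constructor) <;> linarith)
  simpa [Psecond, Pthird, div_self hd.ne'] using key

/-! ### Fixed points of the involution -/

theorem ret_midpoint (lam : ℝ) (m : ℕ) (z : ℝ × ℝ) :
    ret lam m (midpoint ℝ z (ret lam m z)) = midpoint ℝ z (ret lam m z) := by
  rw [← coe_retAffine, AffineMap.map_midpoint, coe_retAffine, ret_ret, midpoint_comm]

/-- When a fixed point is determined by its ordinate, lying on the segment amounts to having an
ordinate between those of its ends. -/
theorem mem_segment_of_fixed {lam : ℝ} {m : ℕ}
    (huniq : ∀ z w, ret lam m z = z → ret lam m w = w → z.2 = w.2 → z = w) {P Q z : ℝ × ℝ}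
    (hP : ret lam m P = P) (hQ : ret lam m Q = Q) (hz : ret lam m z = z)
    (h1 : Q.2 ≤ z.2) (h2 : z.2 ≤ P.2) : z ∈ segment ℝ P Q := by
  have hv : z.2 ∈ segment ℝ P.2 Q.2 := by
    rw [segment_symm, segment_eq_Icc (h1.trans h2)]
    exact ⟨h1, h2⟩
  obtain ⟨a, b, ha, hb, hab, he⟩ := hv
  refine ⟨a, b, ha, hb, hab, huniq _ _ ?_ hz he⟩
  have : ret lam m (a • P + b • Q) = a • ret lam m P + b • ret lam m Q :=
    orbit_combo _ _ _ _ _ _ hab _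
  rw [this, hP, hQ]

/-- The orbit of a fixed point is symmetric about its middle. This one linear equation in the
coordinates suffices for uniqueness at given height. -/
theorem orbit_middle_of_fixed {lam : ℝ} {m : ℕ} {z : ℝ × ℝ} (hz : ret lam m z = z) :
    (orbit lam m z (2 * m + 2)).1 = (orbit lam m z (2 * m)).1 := by
  have h := orbit_ret lam m z (2 * m + 2) (by omega)
  rw [hz, show 4 * m + 3 - (2 * m + 2) = 2 * m + 1 by omega] at h
  rw [h]
  rfl

theorem fixed_unique_one {lam : ℝ} (h0 : 0 < lam) (h1 : lam < 7 / 20) (z w : ℝ × ℝ)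
    (hz : ret lam 1 z = z) (hw : ret lam 1 w = w) (h : z.2 = w.2) : z = w := by
  have ez := orbit_middle_of_fixed hz
  have ew := orbit_middle_of_fixed hw
  simp only [orbit, symbol, step, G] at ez ew
  norm_num at ez ew
  refine Prod.ext ?_ h
  -- This is the coefficient of the abscissa in the middle equation.
  have hne : lam * (3 - lam ^ 2) ≠ 0 := by
    have : 0 < 3 - lam ^ 2 := by nlinarith
    positivity
  apply mul_left_cancel₀ hne
  rw [h] at ez
  linear_combination ez - ew

theorem fixed_unique_two {lam : ℝ} (h0 : 0 < lam) (h1 : lam < 7 / 20) (z w : ℝ × ℝ)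
    (hz : ret lam 2 z = z) (hw : ret lam 2 w = w) (h : z.2 = w.2) : z = w := by
  have ez := orbit_middle_of_fixed hz
  have ew := orbit_middle_of_fixed hw
  simp only [orbit, symbol, step, G] at ez ew
  norm_num at ez ew
  refine Prod.ext ?_ h
  have hne : lam * (5 - 5 * lam ^ 2 + lam ^ 4) ≠ 0 := by
    have : 0 < 5 - 5 * lam ^ 2 + lam ^ 4 := by nlinarith [sq_nonneg lam]
    positivity
  apply mul_left_cancel₀ hne
  rw [h] at ez
  linear_combination ew - ez

/-! ### The first two polygons -/

theorem Pprime_snd_ge {lam : ℝ} (h0 : 0 < lam) (h1 : lam < 7 / 20)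
    (hq : 0 < 1 - 3 * lam + lam ^ 3) :
    2 * (P1 lam 0).2 ≤ 1 + (Pprime lam).2 ∧ (P1 lam 0).2 < 1 := by
  have hd : 0 < 2 - 4 * lam ^ 2 + lam ^ 4 := by nlinarith [sq_nonneg (lam ^ 2)]
  have h2 : 0 < 2 - lam ^ 2 := by nlinarith
  have h3 : 0 < 3 - lam ^ 2 := by linarith
  simp only [P1, Pprime]
  constructor
  · rw [← mul_div_assoc, div_le_iff₀ hd]
    -- This product is exactly the difference of the two sides.
    have := mul_pos (mul_pos h2 h3) (pow_mul_pos h0 hq 3)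
    linarith
  · rw [div_lt_one hd]
    linarith [mul_pos h0 hq]

theorem Pthird_snd_ge {lam : ℝ} (h0 : 0 < lam) (h1 : lam < 7 / 20)
    (hq : 0 < 1 - 3 * lam + lam ^ 3) :
    2 * (P1 lam 1).2 ≤ (Psecond lam).2 + (Pthird lam).2 ∧ 2 * (P1 lam 1).2 ≤ 1 + (P1 lam 2).2 ∧
      (P1 lam 1).2 < 1 := by
  obtain ⟨p1, r1⟩ := pow_succ_bounds h0 h1 1
  obtain ⟨p2, r2⟩ := pow_succ_bounds h0 h1 2
  obtain ⟨p3, r3⟩ := pow_succ_bounds h0 h1 3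
  obtain ⟨p4, r4⟩ := pow_succ_bounds h0 h1 4
  obtain ⟨p5, r5⟩ := pow_succ_bounds h0 h1 5
  obtain ⟨p6, r6⟩ := pow_succ_bounds h0 h1 6
  obtain ⟨p7, r7⟩ := pow_succ_bounds h0 h1 7
  obtain ⟨p8, r8⟩ := pow_succ_bounds h0 h1 8
  obtain ⟨p9, r9⟩ := pow_succ_bounds h0 h1 9
  obtain ⟨p10, r10⟩ := pow_succ_bounds h0 h1 10
  obtain ⟨p11, r11⟩ := pow_succ_bounds h0 h1 11
  obtain ⟨p12, r12⟩ := pow_succ_bounds h0 h1 12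
  obtain ⟨p13, r13⟩ := pow_succ_bounds h0 h1 13
  obtain ⟨p14, r14⟩ := pow_succ_bounds h0 h1 14
  obtain ⟨p15, r15⟩ := pow_succ_bounds h0 h1 15
  norm_num at r1 r2 r3 r4 r5 r6 r7 r8 r9 r10 r11 r12 r13 r14 r15
  have hd : 0 < 2 - 9 * lam ^ 2 + 6 * lam ^ 4 - lam ^ 6 := by linarith
  have hD : 0 < 1 - 6 * lam ^ 2 + 5 * lam ^ 4 - lam ^ 6 := by linarith
  have h3 : 0 < 3 - lam ^ 2 := by linarith
  refine ⟨?_, ?_, ?_⟩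
  · simp only [P1, Psecond, Pthird]
    rw [← add_div, ← mul_div_assoc, div_le_div_iff₀ hd hD]
    linarith
  · have e : 2 * ((0 + 2 : ℕ) : ℝ) - 1 = 3 := by norm_num
    simp only [P1]
    rw [e, tan_quotient_three h0 h1]
    have ht : (1 - lam ^ 2) / (3 - lam ^ 2) ≤ 1 / 3 := by
      rw [div_le_div_iff₀ h3 (by norm_num)]
      linarith
    have hneg : 0 < lam / 2 * (2 - lam ^ 2) := mul_pos (by linarith) (by linarith)
    have hle : 2 * ((2 - 2 * lam - 4 * lam ^ 2 + lam ^ 3 + lam ^ 4) /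
        (2 - 9 * lam ^ 2 + 6 * lam ^ 4 - lam ^ 6)) ≤
        2 + lam ^ 3 / 2 - lam / 2 * (2 - lam ^ 2) * (1 / 3) := by
      rw [← mul_div_assoc, div_le_iff₀ hd]
      linarith [mul_pos h0 hq, pow_mul_pos h0 hq 2, pow_mul_pos h0 hq 3]
    linarith [mul_le_mul_of_nonneg_left ht hneg.le]
  · simp only [P1]
    rw [div_lt_one hd]
    linarith

theorem midpoint_snd (z w : ℝ × ℝ) : (midpoint ℝ z w).2 = (z.2 + w.2) / 2 := by
  rw [midpoint_eq_smul_add, invOf_eq_inv]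
  simp only [Prod.smul_snd, Prod.snd_add, smul_eq_mul]
  ring

theorem admissible_snd_le {lam : ℝ} {m : ℕ} {z : ℝ × ℝ} (hz : z ∈ admissible lam m) :
    z.2 ≤ 1 ∧ (ret lam m z).2 ≤ 1 := ⟨hz.1.2.1, hz.2.1.2.1⟩

theorem first_atom {lam : ℝ} (h0 : 0 < lam) (h1 : lam < 7 / 20)
    (hq : 0 < 1 - 3 * lam + lam ^ 3) (hm : (2 * (1 : ℕ) + 1) * theta lam ≤ π / 2) :
    outVertices lam 1 ⊆ admissible lam 1 ∧
      (∀ v ∈ outVertices lam 1, ret lam 1 v ∈ outVertices lam 1) ∧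
      (∀ v ∈ outVertices lam 1,
        midpoint ℝ v (ret lam 1 v) ∈ segment ℝ (P0 lam 1) (P1 lam 0)) ∧
      ret lam 1 (P0 lam 1) = P0 lam 1 ∧ ret lam 1 (P1 lam 0) = P1 lam 0 ∧
      (interior (convexHull ℝ (outVertices lam 1))).Nonempty := by
  have f1 := ret_P0 h0 h1 le_rfl hm
  obtain ⟨b2, f2⟩ := corner_vertex h0 h1 hq
  obtain ⟨b3, f3⟩ := P1_zero_vertex h0 h1 hq
  have f4 : ret lam 1 (Pprime lam) = (1, 1) := by rw [← f2, ret_ret]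
  obtain ⟨c1, c2⟩ := Pprime_snd_ge h0 h1 hq
  have hmid : midpoint ℝ (1, 1) (Pprime lam) ∈ segment ℝ (P0 lam 1) (P1 lam 0) := by
    have hf := ret_midpoint lam 1 (1, 1)
    rw [f2] at hf
    apply mem_segment_of_fixed (fixed_unique_one h0 h1) f1 f3 hf
    · rw [midpoint_snd]
      linarith
    · rw [midpoint_snd, ← f2]
      have := admissible_snd_le b2
      change _ ≤ (1 : ℝ)
      linarith [this.1, this.2]
  refine ⟨?_, ?_, ?_, f1, f3, ?_⟩
  · rintro v (rfl | rfl | rfl | rfl)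
    · exact P0_mem_admissible h0 h1 hq le_rfl hm
    · exact b2
    · exact b3
    · rw [← f2]
      exact ret_mem_admissible b2
  · rintro v (rfl | rfl | rfl | rfl)
    · rw [f1]; simp [outVertices]
    · rw [f2]; simp [outVertices]
    · rw [f3]; simp [outVertices]
    · rw [f4]; simp [outVertices]
  · rintro v (rfl | rfl | rfl | rfl)
    · rw [f1, midpoint_self]
      exact left_mem_segment ℝ _ _
    · rwa [f2]
    · rw [f3, midpoint_self]
      exact right_mem_segment ℝ _ _
    · rwa [f4, midpoint_comm]
  · exact interior_convexHull_nonempty_of_triangle (a := (P0 lam 1).1) (b := 1)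
      (c := (P1 lam 0).1) (y := (P1 lam 0).2) (P0_fst_lt h0 h1 hq le_rfl hm).ne c2.ne
      (Or.inl rfl) (Or.inr (Or.inl rfl)) (Or.inr (Or.inr (Or.inl rfl)))

theorem second_atom {lam : ℝ} (h0 : 0 < lam) (h1 : lam < 7 / 20)
    (hq : 0 < 1 - 3 * lam + lam ^ 3) (hm : (2 * (2 : ℕ) + 1) * theta lam ≤ π / 2) :
    outVertices lam 2 ⊆ admissible lam 2 ∧
      (∀ v ∈ outVertices lam 2, ret lam 2 v ∈ outVertices lam 2) ∧
      (∀ v ∈ outVertices lam 2,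
        midpoint ℝ v (ret lam 2 v) ∈ segment ℝ (P0 lam 2) (P1 lam 1)) ∧
      ret lam 2 (P0 lam 2) = P0 lam 2 ∧ ret lam 2 (P1 lam 1) = P1 lam 1 ∧
      (interior (convexHull ℝ (outVertices lam 2))).Nonempty := by
  have hθ := theta_pos h0
  have hm5 : (2 * ((1 : ℕ) : ℝ) + 3) * theta lam ≤ π / 2 := by push_cast at hm ⊢; linarith
  have hm3 : (2 * ((1 : ℕ) : ℝ) + 1) * theta lam ≤ π / 2 := by push_cast at hm ⊢; linarith
  have f1 := ret_P0 h0 h1 one_le_two hm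
  have f2 : ret lam 2 (P0 lam 1) = P1 lam 2 := ret_P0_pred h0 h1 le_rfl hm3
  have b2 : P0 lam 1 ∈ admissible lam 2 := P0_pred_mem_admissible h0 h1 hq le_rfl hm5
  obtain ⟨b3, f3⟩ := Psecond_vertex h0 h1 hq
  obtain ⟨b4, f4⟩ := P1_one_vertex h0 h1
  have f5 : ret lam 2 (Pthird lam) = Psecond lam := by rw [← f3, ret_ret]
  have f6 : ret lam 2 (P1 lam 2) = P0 lam 1 := by rw [← f2, ret_ret]
  obtain ⟨c1, c2, c3⟩ := Pthird_snd_ge h0 h1 hq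
  have hmid1 : midpoint ℝ (Psecond lam) (Pthird lam) ∈ segment ℝ (P0 lam 2) (P1 lam 1) := by
    have hf := ret_midpoint lam 2 (Psecond lam)
    rw [f3] at hf
    apply mem_segment_of_fixed (fixed_unique_two h0 h1) f1 f4 hf
    · rw [midpoint_snd]
      linarith
    · rw [midpoint_snd, ← f3]
      have := admissible_snd_le b3
      change _ ≤ (1 : ℝ)
      linarith [this.1, this.2]
  have hmid2 : midpoint ℝ (P0 lam 1) (P1 lam 2) ∈ segment ℝ (P0 lam 2) (P1 lam 1) := by
    have hf := ret_midpoint lam 2 (P0 lam 1)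
    rw [f2] at hf
    apply mem_segment_of_fixed (fixed_unique_two h0 h1) f1 f4 hf
    · rw [midpoint_snd]
      change _ ≤ ((1 : ℝ) + _) / 2
      linarith
    · rw [midpoint_snd, ← f2]
      have := admissible_snd_le b2
      change _ ≤ (1 : ℝ)
      linarith [this.1, this.2]
  refine ⟨?_, ?_, ?_, f1, f4, ?_⟩
  · rintro v (rfl | rfl | rfl | rfl | rfl | rfl)
    · exact P0_mem_admissible h0 h1 hq one_le_two hm
    · exact b2
    · exact b3
    · exact b4
    · rw [← f3]
      exact ret_mem_admissible b3
    · rw [← f2]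
      exact ret_mem_admissible b2
  · rintro v (rfl | rfl | rfl | rfl | rfl | rfl)
    · rw [f1]; simp [outVertices]
    · rw [f2]; simp [outVertices]
    · rw [f3]; simp [outVertices]
    · rw [f4]; simp [outVertices]
    · rw [f5]; simp [outVertices]
    · rw [f6]; simp [outVertices]
  · rintro v (rfl | rfl | rfl | rfl | rfl | rfl)
    · rw [f1, midpoint_self]
      exact left_mem_segment ℝ _ _
    · rwa [f2]
    · rwa [f3]
    · rw [f4, midpoint_self]
      exact right_mem_segment ℝ _ _
    · rwa [f5, midpoint_comm]
    · rwa [f6, midpoint_comm]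
  · refine interior_convexHull_nonempty_of_triangle (a := (P0 lam 2).1) (b := (P0 lam 1).1)
      (c := (P1 lam 1).1) (y := (P1 lam 1).2) ?_ c3.ne
      (Or.inl rfl) (Or.inr (Or.inl rfl)) (Or.inr (Or.inr (Or.inr (Or.inl rfl))))
    have := tan_quotient_lt h0 h1 (j := 1) (by push_cast at hm ⊢; linarith)
    simp only [P0]
    intro h
    norm_num at this h
    linarith

/-! ### The parameters -/

/-- By the triple angle formula at $\pi/18$, $2s$ is a root of $x^3-3x+1$; the cubic factors through
$2s-\lambda$ with a positive cofactor. The cubic is negative on $[7/20,1]$, whence the numerical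
bound. -/
theorem lam_bounds {lam : ℝ} (h0 : 0 < lam) (h : lam < 2 * cos (4 * π / 9)) :
    lam < 7 / 20 ∧ 0 < 1 - 3 * lam + lam ^ 3 := by
  have hcos : cos (4 * π / 9) = sin (π / 18) := by
    rw [← cos_pi_div_two_sub]
    congr 1
    ring
  have h30 : sin (3 * (π / 18)) = 1 / 2 := by
    rw [show 3 * (π / 18) = π / 6 by ring, sin_pi_div_six]
  rw [sin_three] at h30
  rw [hcos] at h
  set s := sin (π / 18)
  have hs : s < 1 / 2 := by
    rw [← sin_pi_div_six]
    apply sin_lt_sin_of_lt_of_le_pi_div_two <;> linarith [pi_pos]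
  have hq : 0 < 1 - 3 * lam + lam ^ 3 := by
    have : (1 - 3 * lam + lam ^ 3) = (2 * s - lam) * (3 - (lam ^ 2 + 2 * s * lam + 4 * s ^ 2)) := by
      linear_combination -2 * h30
    rw [this]
    apply mul_pos
    · linarith
    · nlinarith
  refine ⟨?_, hq⟩
  by_contra! h7
  have hl : 0 ≤ (lam - 7 / 20) * (1 - lam) := mul_nonneg (by linarith) (by linarith)
  nlinarith [mul_nonneg h0.le hl]

/-- Since $1-4\rho=2\theta/\pi$, the bound $m\le M$ says $m+\tfrac12\le\pi/(4\theta)$. It is the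
only way $M$ enters. -/
theorem le_pi_div_two_of_le_M {lam : ℝ} (h0 : 0 < lam) {m : ℕ} (hm1 : 1 ≤ m) (hm : m ≤ M lam) :
    (2 * m + 1) * theta lam ≤ π / 2 := by
  have hθ := theta_pos h0
  rw [M, Nat.le_floor_iff' (by omega)] at hm
  have hrho : 1 - 4 * rho lam = 2 * theta lam / π := by
    rw [rho, theta, arccos]
    field_simp
    ring
  rw [hrho] at hm
  have e : 1 / (2 * (2 * theta lam / π)) = π / (4 * theta lam) := by
    field_simp
    norm_num
  rw [e] at hm
  have h2 : (m : ℝ) + 1 / 2 ≤ π / (4 * theta lam) := by linarith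
  rw [le_div_iff₀ (by positivity)] at h2
  linarith

end PiecewiseRotation

theorem mainTheorem6 (lam : ℝ) (hlam_pos : 0 < lam) (hlam_lt : lam < 2 * Real.cos (4 * Real.pi / 9))
    (m : ℕ) (hm_pos : 1 ≤ m) (hm_le : m ≤ PiecewiseRotation.M lam) :
    -- the outer map is defined on the whole polygon, and is given there by both formulae
    PiecewiseRotation.atomOut lam m ⊆ PiecewiseRotation.LoutDomain lam ∧
    Set.EqOn (PiecewiseRotation.Lout lam)
      ((PiecewiseRotation.F lam)^[4 * m + 3] ∘ PiecewiseRotation.G)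
      (PiecewiseRotation.atomOut lam m) ∧
    Set.EqOn ((PiecewiseRotation.F lam)^[4 * m + 3] ∘ PiecewiseRotation.G)
      (PiecewiseRotation.codeMap lam (PiecewiseRotation.outCode m) ∘ PiecewiseRotation.G)
      (PiecewiseRotation.atomOut lam m) ∧
    -- the chain of equalities of images
    (PiecewiseRotation.Lout lam '' PiecewiseRotation.atomOut lam m =
        ((PiecewiseRotation.F lam)^[4 * m + 3] ∘ PiecewiseRotation.G) ''
          PiecewiseRotation.atomOut lam m ∧
      ((PiecewiseRotation.F lam)^[4 * m + 3] ∘ PiecewiseRotation.G) ''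
          PiecewiseRotation.atomOut lam m =
        (PiecewiseRotation.codeMap lam (PiecewiseRotation.outCode m) ∘ PiecewiseRotation.G) ''
          PiecewiseRotation.atomOut lam m ∧
      (PiecewiseRotation.codeMap lam (PiecewiseRotation.outCode m) ∘ PiecewiseRotation.G) ''
          PiecewiseRotation.atomOut lam m =
        PiecewiseRotation.atomOut lam m) ∧
    -- the fixed set of the outer map in the (open) polygon
    {z | z ∈ PiecewiseRotation.atomOut lam m ∧ PiecewiseRotation.Lout lam z = z} =
      openSegment ℝ (PiecewiseRotation.P0 lam m) (PiecewiseRotation.P1 lam (m - 1)) ∧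
    -- the fixed set of its affine extension to the closed polygon
    {z | z ∈ PiecewiseRotation.closedAtomOut lam m ∧
        PiecewiseRotation.codeMap lam (PiecewiseRotation.outCode m) (PiecewiseRotation.G z) = z} =
      segment ℝ (PiecewiseRotation.P0 lam m) (PiecewiseRotation.P1 lam (m - 1)) := by
  obtain ⟨h1, hq⟩ := PiecewiseRotation.lam_bounds hlam_pos hlam_lt
  have hm := PiecewiseRotation.le_pi_div_two_of_le_M hlam_pos hm_pos hm_le
  -- Only the first two polygons have vertices outside the sinusoidal family with $i\ge1$; from
  -- $m=3$ on the argument is uniform.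
  obtain rfl | rfl | ⟨i, hi1, rfl⟩ : m = 1 ∨ m = 2 ∨ ∃ i, 1 ≤ i ∧ m = i + 2 := by
    by_cases h : m ≤ 2
    · omega
    · exact Or.inr (Or.inr ⟨m - 2, by omega, by omega⟩)
  · obtain ⟨a1, a2, a3, a4, a5, a6⟩ := PiecewiseRotation.first_atom hlam_pos h1 hq hm
    exact PiecewiseRotation.outer_atom hlam_pos h1 hm_pos a1 a2 a3 (Or.inl rfl)
      (Or.inr (Or.inr (Or.inl rfl))) a4 a5 rfl (Or.inl rfl) a6
  · obtain ⟨a1, a2, a3, a4, a5, a6⟩ := PiecewiseRotation.second_atom hlam_pos h1 hq hm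
    exact PiecewiseRotation.outer_atom hlam_pos h1 hm_pos a1 a2 a3 (Or.inl rfl)
      (Or.inr (Or.inr (Or.inr (Or.inl rfl)))) a4 a5 rfl (Or.inl rfl) a6
  · obtain ⟨j, rfl⟩ : ∃ j, i = j + 1 := ⟨i - 1, by omega⟩
    obtain ⟨a1, a2, a3, a4, a5, a6, a7⟩ :=
      PiecewiseRotation.quadrilateral_atom hlam_pos h1 hq hi1 (by push_cast at hm ⊢; linarith)
    exact PiecewiseRotation.outer_atom hlam_pos h1 hm_pos a1 a2 a3 (Or.inl rfl)
      (Or.inr (Or.inr (Or.inl rfl))) a4 a5 rfl (Or.inr a6) a7
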